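/- Let $\Omega\subset\mathbb C$ be an arbitrary set, $f:\Omega\to\mathbb C$ an arbitrary function and $k\ge 2$ an integer. Notation. $\Omega'$ is the set of all $z\in\Omega$ that lie in the closure of $\Omega\setminus\{z\}$. $\mathcal M_k(\Omega)$ is the set of complex $k\times k$ matrices whose eigenvalues all lie in $\Omega$; $\mathcal D_k(\Omega)$ is the set of diagonalizable members of $\mathcal M_k(\Omega)$; $\mathcal M_k^o(\Omega)$ is the set of $X\in\mathcal M_k(\Omega)$ such that every multiple root of the minimal polynomial $\mu_X$ of $X$ lies in $\Omega'$; and $\mathcal Z_k$ is the set of complex $k\times k$ matrices $X$ with $(X-\lambda I)^{k-1}\ne 0=(X-\lambda I)^k$ for some $\lambda\in\mathbb C$. $\|\cdot\|$ is the operator norm induced by the Euclidean norm. For $n\ge1$, $f$ is $n$ times T-differentiable at $a\in\Omega'$ if there are $u_0,\dots,u_n\in\mathbb C$ and $\tau_a:\Omega\to\mathbb C$ with $\tau_a(a)=0$, $\tau_a$ continuous at $a$ and $f(z)=\sum_{j=0}^n\frac{u_j}{j!}(z-a)^j+\tau_a(z)(z-a)^n$ for all $z\in\Omega$; these are unique,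 and one puts $f^{(j)}(a)=u_j$. $f$ is of class $\mathrm{TC}^n$ ($n\ge 1$) if it is $n$ times T-differentiable at each point of $\Omega'$ and the functions $f^{(1)},\dots,f^{(n)}:\Omega'\to\mathbb C$ and $\Omega'\times\Omega\ni(a,x)\mapsto\tau_a(x)\in\mathbb C$ are continuous; $f$ is of class $\mathrm{TC}^0$ if it is continuous; and $f^{(0)}=f$. Functional calculus: $f[X]=P[X]$, where $P$ is any polynomial such that for every root $\lambda$ of $\mu_X$, of multiplicity $p$: $P^{(s)}(\lambda)=f^{(s)}(\lambda)$ for $0\le s<p$ if $\lambda\in\Omega'$, and $P(\lambda)=f(\lambda)$ if $\lambda\notin\Omega'$. This is well defined for $X\in\mathcal D_k(\Omega)$ and arbitrary $f$ (there it only requires $P=f$ on the spectrum of $X$), and for $X\in\mathcal M_k^o(\Omega)\setminus\mathcal Z_k$ if $f$ is of class $\mathrm{TC}^{k-2}$. Write $f_{\mathrm{op}}$ for the map $X\mapsto f[X]$. Divided differences at pairwise different points of $\Omega$: $\Delta(z)f=f(z)$ and $\Delta(z_1,\dots,z_n)f=\dfrac{\Delta(z_2,\dots,z_n)f-\Delta(z_1,\dots,z_{n-1})f}{z_n-z_1}$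 for $n>1$. $f$ is of class $\mathrm{DDB}^{n}$ if for every $z\in\Omega'$ there are $M,\varepsilon>0$ such that $|\Delta(z_1,\dots,z_{n+1})f|\le M$ for all pairwise different $z_1,\dots,z_{n+1}\in\Omega$ with $|z_j-z|\le\varepsilon$ for each $j$. Theorem. The following conditions are equivalent: (i) for every $\lambda\in\Omega'$ there are $\varepsilon>0$ and $M>0$ such that $\|f[X]\|\le M$ whenever $X\in\mathcal D_k(\Omega)$ and $\|X-\lambda I\|\le\varepsilon$; (ii) $f_{\mathrm{op}}:\mathcal D_k(\Omega)\to\mathcal D_k(\mathbb C)$ is continuous; (iii) $f$ is of class $\mathrm{TC}^{k-2}$ and $f_{\mathrm{op}}:\mathcal M_k^o(\Omega)\setminus\mathcal Z_k\to\mathcal M_k(\mathbb C)$ is continuous; (iv) $f$ is of class $\mathrm{DDB}^{k-1}$. Moreover, if (ii) holds, then there are a locally compact set $\tilde\Omega\subset\mathbb C$ with $\tilde\Omega\supset\Omega$ and a function $\tilde f:\tilde\Omega\to\mathbb C$ extending $f$ such that $\tilde f_{\mathrm{op}}:\mathcal D_k(\tilde\Omega)\to\mathcal D_k(\mathbb C)$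 is continuous. -/

import Mathlib

open Polynomial

open scoped Nat Matrix.Norms.L2Operator

noncomputable section

namespace MatCalc

/-! ### Cluster points and T-differentiability

A function `Ω → ℂ` is represented by a function `f : ℂ → ℂ` of which only the values on `Ω`
matter. -/

/-- The set `Ω'` of the cluster points of `Ω` that belong to `Ω`. -/
def clusterPts (Ω : Set ℂ) : Set ℂ := {z ∈ Ω | z ∈ closure (Ω \ {z})}

/-- The Taylor-type expansion of `f` at `a` of order `n` on `Ω`, with coefficients
`u 0, …, u n` and remainder `τ`. -/
def IsTaylorAt (Ω : Set ℂ) (f : ℂ → ℂ) (n : ℕ) (a : ℂ) (u : ℕ → ℂ) (τ : ℂ → ℂ) : Prop :=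
  (∀ z ∈ Ω, f z = (∑ j ∈ Finset.range (n + 1), u j / (j ! : ℂ) * (z - a) ^ j) + τ z * (z - a) ^ n) ∧
    τ a = 0 ∧ ContinuousWithinAt τ Ω a

/-- `f` is `n` times T-differentiable at `a` (used for `1 ≤ n` and `a ∈ Ω'`). -/
def TDiffAt (Ω : Set ℂ) (f : ℂ → ℂ) (n : ℕ) (a : ℂ) : Prop :=
  ∃ (u : ℕ → ℂ) (τ : ℂ → ℂ), IsTaylorAt Ω f n a u τ

open Classical in
/-- The `j`-th T-derivative `f^{(j)}(a)` at a point `a ∈ Ω'`; by convention `f^{(0)} = f`. -/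
def tDeriv (Ω : Set ℂ) (f : ℂ → ℂ) : ℕ → ℂ → ℂ
  | 0, a => f a
  | j + 1, a => if h : TDiffAt Ω f (j + 1) a then h.choose (j + 1) else 0

theorem sum_coeff_unique {Ω : Set ℂ} {f : ℂ → ℂ} {a : ℂ} (ha : a ∈ clusterPts Ω) :
    ∀ {n m : ℕ} {u v : ℕ → ℂ} {τ σ : ℂ → ℂ}, IsTaylorAt Ω f n a u τ → IsTaylorAt Ω f m a v σ →
      ∀ j, j ≤ n → j ≤ m → u j = v j := by
  intro n m u v τ σ hu hv j
  have haΩ : a ∈ Ω := ha.1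
  have hne : (nhdsWithin a (Ω \ {a})).NeBot := mem_closure_iff_nhdsWithin_neBot.1 ha.2
  -- the part of the expansion from order `j` on, divided by the power of order `j`
  have key : ∀ {n : ℕ} {u : ℕ → ℂ} {τ : ℂ → ℂ}, IsTaylorAt Ω f n a u τ → ∀ j ≤ n,
      Filter.Tendsto (fun z => (f z - ∑ i ∈ Finset.range j, u i / (i ! : ℂ) * (z - a) ^ i)
        / (z - a) ^ j) (nhdsWithin a (Ω \ {a})) (nhds (u j / (j ! : ℂ))) := by
    intro n u τ h j hj
    obtain ⟨h1, h2, h3⟩ := h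
    obtain ⟨d, rfl⟩ := Nat.exists_eq_add_of_le hj
    have hτ : Filter.Tendsto τ (nhdsWithin a (Ω \ {a})) (nhds 0) := by
      have := h3.tendsto.mono_left (nhdsWithin_mono a (Set.sdiff_subset (s := Ω) (t := {a})))
      rwa [h2] at this
    have hid : Filter.Tendsto (fun z => z - a) (nhdsWithin a (Ω \ {a})) (nhds 0) := by
      have : Filter.Tendsto (fun z : ℂ => z - a) (nhds a) (nhds (a - a)) :=
        (continuous_id.sub continuous_const).tendsto a
      rw [sub_self] at this
      exact this.mono_left nhdsWithin_le_nhds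
    have hlim : Filter.Tendsto (fun z => (∑ i ∈ Finset.range (d + 1),
        u (j + i) / ((j + i)! : ℂ) * (z - a) ^ i) + τ z * (z - a) ^ d)
        (nhdsWithin a (Ω \ {a})) (nhds (u j / (j ! : ℂ))) := by
      have e : u j / (j ! : ℂ) = (∑ i ∈ Finset.range (d + 1),
        u (j + i) / ((j + i)! : ℂ) * (0 : ℂ) ^ i) + 0 * 0 ^ d := by
        rw [Finset.sum_range_succ']
        simp
      rw [e]
      exact (tendsto_finsetSum _ fun i _ => tendsto_const_nhds.mul (hid.pow i)).add
        (hτ.mul (hid.pow d))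
    refine hlim.congr' ?_
    filter_upwards [self_mem_nhdsWithin] with z hz
    have hza : z - a ≠ 0 := sub_ne_zero.2 (by simpa using hz.2)
    rw [eq_div_iff (pow_ne_zero _ hza), h1 z hz.1, show j + d + 1 = j + (d + 1) by ring,
      Finset.sum_range_add _ j (d + 1), add_mul, Finset.sum_mul]
    have : ∀ i, u (j + i) / ((j + i)! : ℂ) * (z - a) ^ i * (z - a) ^ j =
        u (j + i) / ((j + i)! : ℂ) * (z - a) ^ (j + i) := fun i => by ring
    simp only [this]
    ring
  induction j using Nat.strong_induction_on with
  | _ j ih =>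
    intro hn hm
    have t1 := key hu j hn
    have t2 := key hv j hm
    have hs : ∀ z : ℂ, ∑ i ∈ Finset.range j, u i / (i ! : ℂ) * (z - a) ^ i =
        ∑ i ∈ Finset.range j, v i / (i ! : ℂ) * (z - a) ^ i := fun z =>
      Finset.sum_congr rfl fun i hi => by
        have hi' := Finset.mem_range.1 hi
        rw [ih i hi' (by omega) (by omega)]
    simp only [hs] at t1
    have := tendsto_nhds_unique t1 t2
    have hf : (j ! : ℂ) ≠ 0 := by exact_mod_cast j.factorial_ne_zero
    exact (div_left_inj' hf).1 this

/-- The T-derivatives are the coefficients of every Taylor-type expansion of sufficient order. -/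
theorem tDeriv_eq {Ω : Set ℂ} {f : ℂ → ℂ} {n : ℕ} {a : ℂ} {u : ℕ → ℂ} {τ : ℂ → ℂ}
    (ha : a ∈ clusterPts Ω) (h : IsTaylorAt Ω f n a u τ) : ∀ j ≤ n, tDeriv Ω f j a = u j := by
  -- an expansion may be truncated
  have trunc : ∀ d m (τ : ℂ → ℂ), IsTaylorAt Ω f (m + d) a u τ → ∃ σ, IsTaylorAt Ω f m a u σ := by
    intro d
    induction d with
    | zero => exact fun m τ h => ⟨τ, h⟩
    | succ d ih =>
      intro m τ h
      obtain ⟨h1, h2, h3⟩ := h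
      refine ih m (fun z => (u (m + d + 1) / ((m + d + 1)! : ℂ) + τ z) * (z - a)) ⟨?_, by simp, ?_⟩
      · intro z hz
        rw [h1 z hz, show m + (d + 1) + 1 = (m + d + 1) + 1 by ring, Finset.sum_range_succ,
          show m + (d + 1) = m + d + 1 by ring]
        ring
      · exact (continuousWithinAt_const.add h3).mul
          (continuousWithinAt_id.sub continuousWithinAt_const)
  intro j hj
  cases j with
  | zero =>
    have := h.1 a ha.1
    rw [Finset.sum_range_succ'] at this
    simpa [tDeriv, h.2.1] using this
  | succ j =>
    obtain ⟨d, rfl⟩ := Nat.exists_eq_add_of_le hj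
    obtain ⟨σ, hσ⟩ := trunc d (j + 1) τ h
    have hT : TDiffAt Ω f (j + 1) a := ⟨u, σ, hσ⟩
    obtain ⟨ρ, hρ⟩ := hT.choose_spec
    simp only [tDeriv, dif_pos hT]
    exact sum_coeff_unique ha hρ hσ (j + 1) le_rfl le_rfl

/-- `f` is of class `TC^n` on `Ω`: for `n = 0` it is continuous; for `n ≥ 1` it is `n` times
T-differentiable at every point of `Ω'` (with coefficients the T-derivatives and remainders `τ a`),
and the T-derivatives up to order `n` on `Ω'` and the remainder `(a, x) ↦ τ a x` on `Ω' × Ω`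
are continuous. -/
def IsTC (Ω : Set ℂ) (f : ℂ → ℂ) : ℕ → Prop
  | 0 => ContinuousOn f Ω
  | n + 1 => ∃ τ : ℂ → ℂ → ℂ,
      (∀ a ∈ clusterPts Ω, IsTaylorAt Ω f (n + 1) a (fun j => tDeriv Ω f j a) (τ a)) ∧
      (∀ j, 1 ≤ j → j ≤ n + 1 → ContinuousOn (tDeriv Ω f j) (clusterPts Ω)) ∧
      ContinuousOn (fun p : ℂ × ℂ => τ p.1 p.2) (clusterPts Ω ×ˢ Ω)

/-! ### Divided differences -/

/-- The divided difference `Δ(z 0, …, z n) f` (used for pairwise different points). -/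
def divDiff (f : ℂ → ℂ) : (n : ℕ) → (Fin (n + 1) → ℂ) → ℂ
  | 0, z => f (z 0)
  | n + 1, z => (divDiff f n (Fin.tail z) - divDiff f n (Fin.init z)) / (z (Fin.last (n + 1)) - z 0)

/-- `f` is of class `DDB^n` on `Ω`: its divided differences at `n + 1` different points of `Ω` are
bounded near every point of `Ω'`. -/
def IsDDB (Ω : Set ℂ) (f : ℂ → ℂ) (n : ℕ) : Prop :=
  ∀ c ∈ clusterPts Ω, ∃ M > (0 : ℝ), ∃ ε > (0 : ℝ), ∀ z : Fin (n + 1) → ℂ,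
    (∀ j, z j ∈ Ω) → Function.Injective z → (∀ j, ‖z j - c‖ ≤ ε) → ‖divDiff f n z‖ ≤ M

/-! ### Classes of matrices -/

/-- `X` is similar to a diagonal matrix. -/
def IsDiagonalizable {k : ℕ} (X : Matrix (Fin k) (Fin k) ℂ) : Prop :=
  ∃ P : Matrix (Fin k) (Fin k) ℂ, IsUnit P ∧ (P * X * P⁻¹).IsDiag

/-- The matrices whose eigenvalues all belong to `Ω`. -/
def specMat (k : ℕ) (Ω : Set ℂ) : Set (Matrix (Fin k) (Fin k) ℂ) := {X | spectrum ℂ X ⊆ Ω}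

/-- The diagonalizable matrices whose eigenvalues all belong to `Ω`. -/
def diagMat (k : ℕ) (Ω : Set ℂ) : Set (Matrix (Fin k) (Fin k) ℂ) :=
  {X ∈ specMat k Ω | IsDiagonalizable X}

/-- The matrices with all eigenvalues in `Ω` such that every multiple root of the minimal polynomial
is in `Ω'`. -/
def specMatO (k : ℕ) (Ω : Set ℂ) : Set (Matrix (Fin k) (Fin k) ℂ) :=
  {X ∈ specMat k Ω | ∀ c : ℂ, 2 ≤ (minpoly ℂ X).rootMultiplicity c → c ∈ clusterPts Ω}

/-- The matrices `X` such that `(X - c)^(k-1) ≠ 0 = (X - c)^k` for some scalar `c`. -/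
def singMat (k : ℕ) : Set (Matrix (Fin k) (Fin k) ℂ) :=
  {X | ∃ c : ℂ, (X - c • (1 : Matrix (Fin k) (Fin k) ℂ)) ^ (k - 1) ≠ 0 ∧
    (X - c • (1 : Matrix (Fin k) (Fin k) ℂ)) ^ k = 0}

/-! ### The functional calculus -/

/-- `P` interpolates `f` at the roots of the minimal polynomial of `X`, with T-derivatives up to the
multiplicity at the roots in `Ω'`, and in value only at the other ones. -/
def Interpolates {k : ℕ} (Ω : Set ℂ) (f : ℂ → ℂ) (X : Matrix (Fin k) (Fin k) ℂ) (P : ℂ[X]) : Prop :=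
  ∀ c : ℂ, (minpoly ℂ X).IsRoot c →
    (c ∈ clusterPts Ω → ∀ s < (minpoly ℂ X).rootMultiplicity c,
      (derivative^[s] P).eval c = tDeriv Ω f s c) ∧
    (c ∉ clusterPts Ω → P.eval c = f c)

theorem dvd_of_derivs {P : ℂ[X]} {c : ℂ} {p : ℕ}
    (h : ∀ s < p, (derivative^[s] P).eval c = 0) : (X - C c) ^ p ∣ P := by
  by_cases hP : P = 0
  · simp [hP]
  rcases p with _ | p
  · simp
  rw [← Polynomial.le_rootMultiplicity_iff hP]
  exact Nat.succ_le_of_lt ((Polynomial.lt_rootMultiplicity_iff_isRoot_iterate_derivative hP).2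
    fun m hm => h m (by omega))

theorem derivs_of_dvd {P : ℂ[X]} {c : ℂ} {p : ℕ} (h : (X - C c) ^ p ∣ P) :
    ∀ s < p, (derivative^[s] P).eval c = 0 := by
  intro s hs
  have := pow_sub_dvd_iterate_derivative_of_pow_dvd s h
  exact (dvd_iff_isRoot.1 ((dvd_pow_self _ (by omega)).trans this))

theorem exists_hermite (S : Finset ℂ) (p : ℂ → ℕ) (d : ℂ → ℕ → ℂ) :
    ∃ P : ℂ[X], ∀ c ∈ S, ∀ s < p c, (derivative^[s] P).eval c = d c s := by
  classical
  let T : ℂ → ℂ[X] := fun c => ∑ i ∈ Finset.range (p c), C (d c i / (i ! : ℂ)) * (X - C c) ^ i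
  have hT : ∀ c, ∀ s < p c, (derivative^[s] (T c)).eval c = d c s := by
    intro c s hs
    simp only [T, iterate_derivative_sum, eval_finsetSum, iterate_derivative_C_mul,
      iterate_derivative_X_sub_pow]
    rw [Finset.sum_eq_single s]
    · have hf : (s ! : ℂ) ≠ 0 := by exact_mod_cast s.factorial_ne_zero
      simp [Nat.descFactorial_self]
      field_simp
    · intro i hi his
      rcases lt_or_gt_of_ne his with h | h
      · simp [Nat.descFactorial_of_lt h]
      · have : i - s ≠ 0 := by omega
        simp [this]
    · intro h
      exact absurd (Finset.mem_range.2 hs) h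
  have hcop : Pairwise (Function.onFun IsCoprime fun c : S =>
      Ideal.span {(X - C (c : ℂ)) ^ p c}) := by
    intro a b hab
    simp only [Function.onFun]
    rw [Ideal.isCoprime_span_singleton_iff]
    exact (Polynomial.isCoprime_X_sub_C_of_isUnit_sub
      (sub_ne_zero.2 fun h => hab (Subtype.ext h)).isUnit).pow
  obtain ⟨P, hP⟩ := Ideal.exists_forall_sub_mem_ideal hcop (fun c : S => T c)
  refine ⟨P, fun c hc s hs => ?_⟩
  have h := Ideal.mem_span_singleton.1 (hP ⟨c, hc⟩)
  have := derivs_of_dvd h s hs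
  rw [iterate_derivative_sub, eval_sub, sub_eq_zero] at this
  rw [this, hT c s hs]

theorem exists_interpolates {k : ℕ} (Ω : Set ℂ) (f : ℂ → ℂ) (X : Matrix (Fin k) (Fin k) ℂ) :
    ∃ P : ℂ[X], Interpolates Ω f X P := by
  classical
  have h0 : minpoly ℂ X ≠ 0 := minpoly.ne_zero (Matrix.isIntegral X)
  obtain ⟨P, hP⟩ := exists_hermite (minpoly ℂ X).roots.toFinset
    (fun c => (minpoly ℂ X).rootMultiplicity c) (fun c s => tDeriv Ω f s c)
  refine ⟨P, fun c hc => ?_⟩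
  have hmem : c ∈ (minpoly ℂ X).roots.toFinset := by simpa [h0] using hc
  refine ⟨fun _ => hP c hmem, fun _ => ?_⟩
  simpa [tDeriv] using hP c hmem 0 ((rootMultiplicity_pos h0).2 hc)

/-- The matrix `f[X] = P[X]`, where `P` is an interpolating polynomial. For diagonalizable `X` only
the values of `f` on the spectrum of `X` enter, so that `f` may be arbitrary. -/
def matCalc {k : ℕ} (Ω : Set ℂ) (f : ℂ → ℂ) (X : Matrix (Fin k) (Fin k) ℂ) :
    Matrix (Fin k) (Fin k) ℂ :=
  aeval X (exists_interpolates Ω f X).choose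

/-- `f[X]` does not depend on the choice of the polynomial. -/
theorem matCalc_eq {k : ℕ} {Ω : Set ℂ} {f : ℂ → ℂ} {X : Matrix (Fin k) (Fin k) ℂ}
    (hX : X ∈ specMatO k Ω) {P : ℂ[X]} (hP : Interpolates Ω f X P) :
    matCalc Ω f X = aeval X P := by
  set Q := (exists_interpolates Ω f X).choose with hQdef
  have hQ : Interpolates Ω f X Q := (exists_interpolates Ω f X).choose_spec
  have h0 : minpoly ℂ X ≠ 0 := minpoly.ne_zero (Matrix.isIntegral X)
  have hdvd : minpoly ℂ X ∣ Q - P := by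
    by_cases hz : Q - P = 0
    · simp [hz]
    refine (IsAlgClosed.splits (minpoly ℂ X)).dvd_of_roots_le_roots h0 ?_
    rw [Multiset.le_iff_count]
    intro c
    rw [count_roots, count_roots]
    by_cases hc : (minpoly ℂ X).IsRoot c
    · rw [Polynomial.le_rootMultiplicity_iff hz]
      apply dvd_of_derivs
      intro s hs
      rw [iterate_derivative_sub, eval_sub, sub_eq_zero]
      by_cases hcl : c ∈ clusterPts Ω
      · rw [(hQ c hc).1 hcl s hs, (hP c hc).1 hcl s hs]
      · have h2 : ¬ 2 ≤ (minpoly ℂ X).rootMultiplicity c := fun h => hcl (hX.2 c h)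
        have hs0 : s = 0 := by omega
        subst hs0
        simpa using ((hQ c hc).2 hcl).trans ((hP c hc).2 hcl).symm
    · rw [rootMultiplicity_eq_zero hc]
      exact Nat.zero_le _
  obtain ⟨R, hR⟩ := hdvd
  have : aeval X (Q - P) = 0 := by rw [hR, map_mul, minpoly.aeval, zero_mul]
  rw [map_sub, sub_eq_zero] at this
  exact this

/-- On diagonalizable matrices, `f[X] = W[X]` for every polynomial `W` that agrees with `f` on the
spectrum of `X`. -/
theorem matCalc_eq_of_diag {k : ℕ} {Ω : Set ℂ} {f : ℂ → ℂ} {X : Matrix (Fin k) (Fin k) ℂ}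
    (hX : X ∈ diagMat k Ω) {W : ℂ[X]} (hW : ∀ c ∈ spectrum ℂ X, W.eval c = f c) :
    matCalc Ω f X = aeval X W := by
  classical
  obtain ⟨P, hPu, hD⟩ := hX.2
  have h0 : minpoly ℂ X ≠ 0 := minpoly.ne_zero (Matrix.isIntegral X)
  have hdet : IsUnit P.det := (Matrix.isUnit_iff_isUnit_det P).1 hPu
  set D := P * X * P⁻¹ with hDdef
  have hXD : X = P⁻¹ * D * P := by
    rw [hDdef]
    simp only [Matrix.mul_assoc, Matrix.nonsing_inv_mul P hdet, Matrix.mul_one]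
    rw [← Matrix.mul_assoc, Matrix.nonsing_inv_mul P hdet, Matrix.one_mul]
  -- the product of the different linear factors annihilates `X`
  have hsq : ∀ c, (minpoly ℂ X).rootMultiplicity c ≤ 1 := by
    let S : Finset ℂ := Finset.univ.image fun i => D i i
    let q : ℂ[X] := ∏ c ∈ S, (Polynomial.X - C c)
    have hqD : aeval D q = 0 := by
      have hdd : D = Matrix.diagonal (fun i => D i i) := (hD.diagonal_diag).symm
      have : aeval D q = Matrix.diagonal (fun i => q.eval (D i i)) := by
        conv_lhs => rw [hdd]
        have := Polynomial.aeval_algHom_apply (Matrix.diagonalAlgHom (n := Fin k) (α := ℂ) ℂ)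
          (fun i => D i i) q
        refine this.trans ?_
        have hpi : aeval (fun i => D i i) q = fun i => q.eval (D i i) := by
          funext i
          rw [Polynomial.aeval_fn_apply, Polynomial.coe_aeval_eq_eval]
        rw [hpi]
        rfl
      rw [this]
      have hz : (fun i => q.eval (D i i)) = 0 := by
        funext i
        simp only [q, eval_prod, Pi.zero_apply]
        exact Finset.prod_eq_zero (Finset.mem_image_of_mem _ (Finset.mem_univ i)) (by simp)
      rw [hz]
      simp
    have hconj : ∀ r : ℂ[X], aeval X r = P⁻¹ * aeval D r * P := by
      intro r
      induction r using Polynomial.induction_on' with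
      | add a b ha hb => simp [ha, hb, Matrix.mul_add, Matrix.add_mul]
      | monomial n a =>
        simp only [aeval_monomial, Algebra.algebraMap_eq_smul_one, smul_mul_assoc, one_mul,
          Matrix.mul_smul]
        congr 1
        induction n with
        | zero => simp [Matrix.nonsing_inv_mul P hdet]
        | succ n ih =>
          rw [pow_succ, ih, pow_succ, hXD]
          simp only [Matrix.mul_assoc]
          rw [← Matrix.mul_assoc P P⁻¹, Matrix.mul_nonsing_inv P hdet, Matrix.one_mul]
    have hqX : aeval X q = 0 := by rw [hconj, hqD]; simp
    have hdv : minpoly ℂ X ∣ q := minpoly.dvd ℂ X hqX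
    have hsep : q.Separable := separable_prod_X_sub_C_iff'.2 (fun _ _ _ _ h => h)
    intro c
    exact rootMultiplicity_le_one_of_separable (hsep.of_dvd hdv) c
  refine matCalc_eq ⟨hX.1, fun c hc => absurd hc (by have := hsq c; omega)⟩ fun c hc => ?_
  have hcs : c ∈ spectrum ℂ X := by
    have := (Module.End.hasEigenvalue_iff_isRoot (f := Matrix.toLin' X) (μ := c)).2 (by
      rwa [Matrix.minpoly_toLin'])
    have := this.mem_spectrum
    rwa [Matrix.spectrum_toLin'] at this
  refine ⟨fun _ s hs => ?_, fun _ => hW c hcs⟩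
  have : s = 0 := by have := hsq c; omega
  subst this
  simpa [tDeriv] using hW c hcs

end MatCalc

end

/-! For a matrix with different eigenvalues, `f[X]` is the value at `X` of the Lagrange polynomial
of `f` at the eigenvalues, and Newton's formula writes this polynomial as a sum of divided
differences times products of linear factors. Bounds for `f[X]` and bounds for divided differences
at up to k points therefore control each other.

From matrices to divided differences: a bidiagonal matrix with different diagonal entries near c and
a small η above the diagonal is diagonalizable and close to cI, and the corner entry of its image
under the calculus is η^(k-1) times the divided difference of the diagonal (`matCalc_bidiag`,
`isDDB_of_bounded`).

From divided differences to continuity: limits are tested along ultrafilters, where bounded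
quantities converge. For converging nodes the divided differences converge too: either two limits
differ and the recursion lowers the order, or all nodes approach one point and the local bound
applies (`NodesTo.exists_tendsto_nodeDiff`). Hence interpolation polynomials converge. Where at most
k-1 nodes meet, the error formula shows that the limit has the T-derivatives of `f` there
(`NodesTo.exists_hermite`), so its value at the limit matrix is the functional calculus. If k nodes
meet at c, one more Newton term l(X-c)^(k-1) appears, and it vanishes at matrices outside Z_k.
Matrices with multiple roots are handled by first moving the nodes apart slightly (`exists_approx`).
The same error formula, with all nodes tending to one point a, gives Taylor remainders that are
uniform in a, hence the class TC^(k-2) (`isTC_of_locDiffBound`).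

The remaining implications are restriction to the diagonalizable matrices, which lie in the larger
domain, and continuity at cI. For the extension, `f` is locally Lipschitz near the points of the
closure where divided differences stay bounded. It extends there by limits, and the bounds survive.
-/

noncomputable section

namespace MatCalc

/-! ### Interpolation polynomials and divided differences -/

section Interpolation

variable {J : Type*} [DecidableEq J]

/-- The Lagrange interpolation polynomial of `f` at the nodes `z j`, `j ∈ s`. -/
def interp (f : ℂ → ℂ) (s : Finset J) (z : J → ℂ) : ℂ[X] :=
  Lagrange.interpolate s z fun j => f (z j)

/-- The divided difference of `f` at the nodes `z j`, `j ∈ s`. -/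
def nodeDiff (f : ℂ → ℂ) (s : Finset J) (z : J → ℂ) : ℂ :=
  (interp f s z).coeff (s.card - 1)

variable {f : ℂ → ℂ} {s : Finset J} {z : J → ℂ}

theorem degree_interp_lt (hz : Set.InjOn z s) : (interp f s z).degree < s.card :=
  Lagrange.degree_interpolate_lt _ hz

theorem eval_interp (hz : Set.InjOn z s) {j : J} (hj : j ∈ s) :
    (interp f s z).eval (z j) = f (z j) :=
  Lagrange.eval_interpolate_at_node _ hz hj

theorem eq_interp (hz : Set.InjOn z s) {P : ℂ[X]} (hd : P.degree < s.card)
    (hP : ∀ j ∈ s, P.eval (z j) = f (z j)) : P = interp f s z :=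
  Lagrange.eq_interpolate_of_eval_eq _ hz hd hP

@[simp] theorem interp_empty : interp f (∅ : Finset J) z = 0 := by simp [interp]

@[simp] theorem nodeDiff_empty : nodeDiff f (∅ : Finset J) z = 0 := by simp [nodeDiff]

@[simp] theorem interp_singleton (j : J) : interp f {j} z = C (f (z j)) := by simp [interp]

@[simp] theorem nodeDiff_singleton (j : J) : nodeDiff f {j} z = f (z j) := by simp [nodeDiff]

/-- This explicit form is continuous in nodes and values as long as the nodes stay apart; it serves
to carry bounds over to the extension of `f`. -/
theorem nodeDiff_eq_sum (hz : Set.InjOn z s) :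
    nodeDiff f s z = ∑ i ∈ s, f (z i) / ∏ j ∈ s.erase i, (z i - z j) := by
  rw [nodeDiff, Lagrange.coeff_eq_sum hz (degree_interp_lt hz)]
  exact Finset.sum_congr rfl fun i hi => by rw [eval_interp hz hi]

theorem coeff_interp_of_le (hz : Set.InjOn z s) {n : ℕ} (hn : s.card ≤ n) :
    (interp f s z).coeff n = 0 :=
  coeff_eq_zero_of_degree_lt ((degree_interp_lt hz).trans_le (by exact_mod_cast hn))

/-- The recursion for divided differences. -/
theorem sub_mul_nodeDiff (hz : Set.InjOn z s) {a b : J} (ha : a ∈ s) (hb : b ∈ s) (hab : a ≠ b) :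
    (z a - z b) * nodeDiff f s z = nodeDiff f (s.erase b) z - nodeDiff f (s.erase a) z := by
  have hne : z a - z b ≠ 0 := sub_ne_zero.2 fun h => hab (hz ha hb h)
  have hne' : z b - z a ≠ 0 := sub_ne_zero.2 fun h => hab (hz ha hb h.symm)
  have hcard : 1 < s.card := Finset.one_lt_card.2 ⟨a, ha, b, hb, hab⟩
  obtain ⟨n, hn⟩ : ∃ n, s.card = n + 2 := ⟨s.card - 2, by omega⟩
  have hca : (s.erase a).card = n + 1 := by rw [Finset.card_erase_of_mem ha, hn]; rfl
  have hcb : (s.erase b).card = n + 1 := by rw [Finset.card_erase_of_mem hb, hn]; rfl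
  have hza : Set.InjOn z (s.erase a) := hz.mono (by exact_mod_cast Finset.erase_subset a s)
  have hzb : Set.InjOn z (s.erase b) := hz.mono (by exact_mod_cast Finset.erase_subset b s)
  have key : interp f s z = interp f (s.erase b) z * Lagrange.basisDivisor (z a) (z b) +
      interp f (s.erase a) z * Lagrange.basisDivisor (z b) (z a) :=
    Lagrange.interpolate_eq_add_interpolate_erase _ hz ha hb hab
  have hcoef : ∀ (p : ℂ[X]) (x y : ℂ), p.coeff (n + 1) = 0 →
      (p * Lagrange.basisDivisor x y).coeff (n + 1) = (x - y)⁻¹ * p.coeff n := by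
    intro p x y hp
    rw [Lagrange.basisDivisor, mul_left_comm, coeff_C_mul, mul_sub, coeff_sub, coeff_mul_X,
      coeff_mul_C, hp]
    ring
  have h1 : s.card - 1 = n + 1 := by omega
  simp only [nodeDiff, h1, hca, hcb, Nat.add_sub_cancel]
  rw [key, coeff_add, hcoef _ _ _ (coeff_interp_of_le hzb hcb.le),
    hcoef _ _ _ (coeff_interp_of_le hza hca.le)]
  field_simp
  ring

/-- Newton's formula. -/
theorem interp_insert {j : J} (hj : j ∉ s) (hz : Set.InjOn z (insert j s : Finset J)) :
    interp f (insert j s) z =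
      interp f s z + C (nodeDiff f (insert j s) z) * Lagrange.nodal s z := by
  have hzs : Set.InjOn z s := hz.mono (by exact_mod_cast Finset.subset_insert j s)
  have hcard : (insert j s).card = s.card + 1 := Finset.card_insert_of_notMem hj
  have hcoef : (interp f (insert j s) z - C (nodeDiff f (insert j s) z) *
      Lagrange.nodal s z).coeff s.card = 0 := by
    have h1 : (Lagrange.nodal s z).coeff s.card = 1 := by
      have := (Lagrange.nodal_monic (s := s) (v := z)).coeff_natDegree
      rwa [Lagrange.natDegree_nodal] at this
    rw [coeff_sub, coeff_C_mul, h1, nodeDiff, hcard]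
    simp
  rw [← sub_eq_iff_eq_add]
  refine eq_interp hzs ?_ fun i hi => ?_
  · rw [degree_lt_iff_coeff_zero]
    intro m hm
    rcases hm.eq_or_lt with rfl | hlt
    · exact hcoef
    · rw [coeff_sub, coeff_C_mul, coeff_interp_of_le hz (by omega),
        coeff_eq_zero_of_natDegree_lt (p := Lagrange.nodal s z)
          (by rw [Lagrange.natDegree_nodal]; exact hlt)]
      simp
  · rw [eval_sub, eval_mul, Lagrange.eval_nodal_at_node hi, mul_zero, sub_zero,
      eval_interp hz (Finset.mem_insert_of_mem hi)]

/-- Bounds are stated for finite subsets of ℂ, limits for families with a fixed index set; this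
links the two. -/
theorem interp_image (hz : Set.InjOn z s) : interp f (s.image z) id = interp f s z := by
  symm
  refine eq_interp Function.injective_id.injOn ?_ fun x hx => ?_
  · rw [Finset.card_image_of_injOn hz]; exact degree_interp_lt hz
  · obtain ⟨j, hj, rfl⟩ := Finset.mem_image.1 hx
    exact eval_interp hz hj

theorem nodeDiff_image (hz : Set.InjOn z s) : nodeDiff f (s.image z) id = nodeDiff f s z := by
  rw [nodeDiff, nodeDiff, interp_image hz, Finset.card_image_of_injOn hz]

/-- The error of interpolation. -/
theorem sub_eval_interp {s : Finset ℂ} {x : ℂ} (hx : x ∉ s) :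
    f x - (interp f s id).eval x = nodeDiff f (insert x s) id * ∏ y ∈ s, (x - y) := by
  have h := congrArg (eval x) (interp_insert (f := f) (z := id) hx Function.injective_id.injOn)
  have h1 : (interp f (insert x s) id).eval x = f x :=
    eval_interp (z := id) Function.injective_id.injOn (Finset.mem_insert_self x s)
  rw [h1, eval_add, eval_mul, eval_C, Lagrange.eval_nodal] at h
  rw [h]
  simp

end Interpolation

/-- Both sides obey the same recursion. The leading coefficient depends only on the set of nodes, so
the order of the points is irrelevant. -/
theorem divDiff_eq_nodeDiff (f : ℂ → ℂ) : ∀ (n : ℕ) (z : Fin (n + 1) → ℂ), Function.Injective z →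
    divDiff f n z = nodeDiff f (Finset.univ.image z) id
  | 0, z, _ => by
    have : (Finset.univ.image z) = {z 0} := by ext x; simp
    rw [this]; simp [divDiff]
  | n + 1, z, hz => by
    have hl : z (Fin.last (n + 1)) ≠ z 0 := fun h => by
      have := hz h; simp [Fin.ext_iff] at this
    have ht : Function.Injective (Fin.tail z) := hz.comp (Fin.succ_injective _)
    have hi : Function.Injective (Fin.init z) := hz.comp (Fin.castSucc_injective _)
    rw [divDiff, divDiff_eq_nodeDiff f n _ ht, divDiff_eq_nodeDiff f n _ hi,
      div_eq_iff (sub_ne_zero.2 hl), mul_comm]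
    have e1 : Finset.univ.image (Fin.tail z) = (Finset.univ.image z).erase (z 0) := by
      ext x
      simp only [Finset.mem_image, Finset.mem_univ, true_and, Finset.mem_erase, Fin.tail]
      constructor
      · rintro ⟨i, rfl⟩
        exact ⟨fun h => Fin.succ_ne_zero i (hz h), _, rfl⟩
      · rintro ⟨h, i, rfl⟩
        have : i ≠ 0 := fun h0 => h (by rw [h0])
        exact ⟨i.pred this, by simp⟩
    have e2 : Finset.univ.image (Fin.init z) =
        (Finset.univ.image z).erase (z (Fin.last (n + 1))) := by
      ext x
      simp only [Finset.mem_image, Finset.mem_univ, true_and, Finset.mem_erase, Fin.init]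
      constructor
      · rintro ⟨i, rfl⟩
        exact ⟨fun h => (Fin.castSucc_lt_last i).ne (hz h), _, rfl⟩
      · rintro ⟨h, i, rfl⟩
        have : i ≠ Fin.last (n + 1) := fun h0 => h (by rw [h0])
        exact ⟨i.castPred this, by simp⟩
    rw [e1, e2]
    exact (sub_mul_nodeDiff (z := id) (s := Finset.univ.image z) Function.injective_id.injOn
      (Finset.mem_image_of_mem _ (Finset.mem_univ _))
      (Finset.mem_image_of_mem _ (Finset.mem_univ _)) hl).symm

/-! ### Bounded divided differences -/

/-- The divided differences of `f` at `m` different points of `S` are bounded by `M`. -/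
def DiffBound (f : ℂ → ℂ) (S : Set ℂ) (m : ℕ) (M : ℝ) : Prop :=
  ∀ s : Finset ℂ, (s : Set ℂ) ⊆ S → s.card = m → ‖nodeDiff f s id‖ ≤ M

theorem DiffBound.mono {f : ℂ → ℂ} {S T : Set ℂ} {m : ℕ} {M N : ℝ} (h : DiffBound f S m M)
    (hT : T ⊆ S) (hM : M ≤ N) : DiffBound f T m N :=
  fun s hs hm => (h s (hs.trans hT) hm).trans hM

/-- Fix one m-point set `w` and turn `s` into `w` by exchanging a point a for a point b, at most m
times. By the recursion each exchange changes the divided difference by (a-b) times one at m+1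
points, hence by at most `D * M`. -/
theorem DiffBound.pred {f : ℂ → ℂ} {S : Set ℂ} {m : ℕ} {M D : ℝ}
    (hS : ∀ x ∈ S, ∀ y ∈ S, ‖x - y‖ ≤ D) (h : DiffBound f S (m + 1) M) :
    ∃ N, DiffBound f S m N := by
  classical
  by_cases hw : ∃ w : Finset ℂ, (w : Set ℂ) ⊆ S ∧ w.card = m
  swap
  · exact ⟨0, fun s hs hm => absurd ⟨s, hs, hm⟩ hw⟩
  obtain ⟨w, hwS, hwm⟩ := hw
  have main : ∀ (r : ℕ) (s : Finset ℂ), (s : Set ℂ) ⊆ S → s.card = m → (s \ w).card = r →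
      ‖nodeDiff f s id‖ ≤ ‖nodeDiff f w id‖ + r * (D * M) := by
    intro r
    induction r with
    | zero =>
      intro s hs hm hr
      have hsw : s ⊆ w := Finset.sdiff_eq_empty_iff_subset.1 (Finset.card_eq_zero.1 hr)
      have : s = w := Finset.eq_of_subset_of_card_le hsw (by omega)
      simp [this]
    | succ r ih =>
      intro s hs hm hr
      obtain ⟨a, ha⟩ : (s \ w).Nonempty := Finset.card_pos.1 (by omega)
      have hws : (w \ s).card = r + 1 := by
        have h1 := Finset.card_sdiff_add_card_inter s w
        have h2 := Finset.card_sdiff_add_card_inter w s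
        rw [Finset.inter_comm] at h2
        omega
      obtain ⟨b, hb⟩ : (w \ s).Nonempty := Finset.card_pos.1 (by omega)
      rw [Finset.mem_sdiff] at ha hb
      have hab : a ≠ b := fun e => ha.2 (e ▸ hb.1)
      have hins : ((insert b s : Finset ℂ) : Set ℂ) ⊆ S := by
        rw [Finset.coe_insert]; exact Set.insert_subset (hwS hb.1) hs
      have hrec := sub_mul_nodeDiff (f := f) (z := id) (s := insert b s)
        Function.injective_id.injOn (Finset.mem_insert_of_mem ha.1) (Finset.mem_insert_self b s) hab
      rw [Finset.erase_insert hb.2] at hrec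
      have hcard : (insert b s).card = m + 1 := by rw [Finset.card_insert_of_notMem hb.2, hm]
      have h1 := ih ((insert b s).erase a)
        ((Finset.coe_subset.2 (Finset.erase_subset _ _)).trans hins)
        (by rw [Finset.card_erase_of_mem (Finset.mem_insert_of_mem ha.1), hcard]; rfl) (by
          have : (insert b s).erase a \ w = (s \ w).erase a := by
            ext x
            simp only [Finset.mem_sdiff, Finset.mem_erase, Finset.mem_insert]
            constructor
            · rintro ⟨⟨h1, rfl | h2⟩, h3⟩
              · exact absurd hb.1 h3
              · exact ⟨h1, h2, h3⟩
            · rintro ⟨h1, h2, h3⟩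
              exact ⟨⟨h1, Or.inr h2⟩, h3⟩
          rw [this, Finset.card_erase_of_mem (Finset.mem_sdiff.2 ha), hr]; rfl)
      have h2 := h _ hins hcard
      have h3 : ‖(id a - id b) * nodeDiff f (insert b s) id‖ ≤ D * M := by
        rw [norm_mul]
        exact mul_le_mul (hS _ (hs ha.1) _ (hwS hb.1)) h2 (norm_nonneg _)
          ((norm_nonneg _).trans (hS _ (hs ha.1) _ (hwS hb.1)))
      have h4 : nodeDiff f s id = (id a - id b) * nodeDiff f (insert b s) id +
          nodeDiff f ((insert b s).erase a) id := by rw [hrec]; ring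
      rw [h4]
      refine (norm_add_le _ _).trans ?_
      push_cast
      linarith
  by_cases hDM : 0 ≤ D * M
  · refine ⟨‖nodeDiff f w id‖ + m * (D * M), fun s hs hm => (main _ s hs hm rfl).trans ?_⟩
    have : ((s \ w).card : ℝ) ≤ m := by
      exact_mod_cast hm ▸ Finset.card_le_card Finset.sdiff_subset
    nlinarith
  · refine ⟨‖nodeDiff f w id‖, fun s hs hm => (main _ s hs hm rfl).trans ?_⟩
    have : (0 : ℝ) ≤ (s \ w).card := by positivity
    nlinarith

theorem DiffBound.all {f : ℂ → ℂ} {S : Set ℂ} {D : ℝ}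
    (hS : ∀ x ∈ S, ∀ y ∈ S, ‖x - y‖ ≤ D) :
    ∀ {k : ℕ} {M : ℝ}, DiffBound f S k M → ∃ N > 0, ∀ m ≤ k, DiffBound f S m N := by
  intro k
  induction k with
  | zero =>
    intro M h
    refine ⟨max M 1, by positivity, fun m hm => ?_⟩
    obtain rfl : m = 0 := by omega
    exact h.mono le_rfl (le_max_left _ _)
  | succ k ih =>
    intro M h
    obtain ⟨N, hN⟩ := h.pred hS
    obtain ⟨N', hN'0, hN'⟩ := ih hN
    refine ⟨max M N', by positivity, fun m hm => ?_⟩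
    rcases hm.eq_or_lt with rfl | hlt
    · exact h.mono le_rfl (le_max_left _ _)
    · exact (hN' m (by omega)).mono le_rfl (le_max_right _ _)

/-- The divided differences of `f` at up to `k` different points of `Ω` are bounded near `c`. -/
def LocDiffBound (Ω : Set ℂ) (f : ℂ → ℂ) (k : ℕ) (c : ℂ) : Prop :=
  ∃ ε > (0 : ℝ), ∃ M > (0 : ℝ), ∀ m ≤ k, DiffBound f (Ω ∩ Metric.closedBall c ε) m M

theorem LocDiffBound.of_diffBound {Ω : Set ℂ} {f : ℂ → ℂ} {k : ℕ} {c : ℂ} {ε M : ℝ} (hε : 0 < ε)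
    (h : DiffBound f (Ω ∩ Metric.closedBall c ε) k M) : LocDiffBound Ω f k c := by
  refine ⟨ε, hε, DiffBound.all (D := ε + ε) ?_ h⟩
  intro x hx y hy
  rw [← dist_eq_norm]
  exact (dist_triangle_right x y c).trans
    (add_le_add (Metric.mem_closedBall.1 hx.2) (Metric.mem_closedBall.1 hy.2))

theorem diffBound_of_divDiff {f : ℂ → ℂ} {S : Set ℂ} {n : ℕ} {M : ℝ}
    (h : ∀ z : Fin (n + 1) → ℂ, (∀ j, z j ∈ S) → Function.Injective z → ‖divDiff f n z‖ ≤ M) :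
    DiffBound f S (n + 1) M := by
  intro s hs hm
  let e := s.equivFinOfCardEq hm
  let z : Fin (n + 1) → ℂ := fun i => (e.symm i : ℂ)
  have hz : Function.Injective z := Subtype.val_injective.comp e.symm.injective
  have him : Finset.univ.image z = s := by
    ext x
    simp only [Finset.mem_image, Finset.mem_univ, true_and]
    constructor
    · rintro ⟨i, rfl⟩; exact (e.symm i).2
    · intro hx; exact ⟨e ⟨x, hx⟩, by simp [z]⟩
  have := h z (fun j => hs (e.symm j).2) hz
  rwa [divDiff_eq_nodeDiff f n z hz, him] at this

theorem isolated_of_notMem {Ω : Set ℂ} {c : ℂ} (h : c ∈ Ω) (hc : c ∉ clusterPts Ω) :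
    ∃ ε > (0 : ℝ), Ω ∩ Metric.closedBall c ε ⊆ {c} := by
  have : c ∉ closure (Ω \ {c}) := fun h' => hc ⟨h, h'⟩
  rw [Metric.mem_closure_iff] at this
  push Not at this
  obtain ⟨ε, hε, hd⟩ := this
  refine ⟨ε / 2, by positivity, fun x hx => ?_⟩
  by_contra hxc
  have := hd x ⟨hx.1, hxc⟩
  have h2 := Metric.mem_closedBall.1 hx.2
  rw [dist_comm] at h2
  linarith

/-- At an isolated point a small ball contains no other point of `Ω`, so only the empty set and {c}
have to be bounded. Cluster and isolated points can thus be treated alike from here on. -/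
theorem IsDDB.locDiffBound {Ω : Set ℂ} {f : ℂ → ℂ} {n : ℕ} (h : IsDDB Ω f n) {c : ℂ} (hc : c ∈ Ω) :
    LocDiffBound Ω f (n + 1) c := by
  by_cases hcl : c ∈ clusterPts Ω
  · obtain ⟨M, -, ε, hε, hb⟩ := h c hcl
    refine LocDiffBound.of_diffBound hε (diffBound_of_divDiff (M := M) fun z hz hinj =>
      hb z (fun j => (hz j).1) hinj fun j => ?_)
    rw [← dist_eq_norm]
    exact Metric.mem_closedBall.1 (hz j).2
  · obtain ⟨ε, hε, hs⟩ := isolated_of_notMem hc hcl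
    refine ⟨ε, hε, ‖f c‖ + 1, by positivity, fun m _ s hsS _ => ?_⟩
    have hsub : s ⊆ {c} := by
      rw [← Finset.coe_subset, Finset.coe_singleton]
      exact hsS.trans hs
    rcases Finset.subset_singleton_iff.1 hsub with rfl | rfl
    · simp; positivity
    · simp

/-! ### Limits along ultrafilters -/

open Filter Topology

/-- Compactness of closed balls: along an ultrafilter a bound already yields a limit, without
passing to subsequences. -/
theorem exists_tendsto_of_bounded {ι : Type*} (U : Ultrafilter ι) {g : ι → ℂ} {M : ℝ}
    (h : ∀ᶠ t in (U : Filter ι), ‖g t‖ ≤ M) : ∃ l, Tendsto g U (𝓝 l) := by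
  obtain ⟨l, -, hl⟩ := (isCompact_closedBall (0 : ℂ) M).ultrafilter_le_nhds (U.map g) (by
    rw [le_principal_iff]
    exact h.mono fun t ht => by simpa using ht)
  exact ⟨l, hl⟩

/-- The nodes `z t j ∈ Ω`, `j ∈ T`, are eventually different and converge to points `w j` near which
divided differences of up to `k` points are bounded; at most `k` of the limits coincide. -/
structure NodesTo {ι J : Type*} [DecidableEq J] (U : Ultrafilter ι) (Ω : Set ℂ) (f : ℂ → ℂ)
    (k : ℕ) (z : ι → J → ℂ) (w : J → ℂ) (T : Finset J) : Prop where
  injOn : ∀ᶠ t in (U : Filter ι), Set.InjOn (z t) T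
  mem : ∀ᶠ t in (U : Filter ι), ∀ j ∈ T, z t j ∈ Ω
  tendsto : ∀ j ∈ T, Tendsto (fun t => z t j) U (𝓝 (w j))
  bound : ∀ j ∈ T, LocDiffBound Ω f k (w j)
  card_le : ∀ c, (T.filter fun j => w j = c).card ≤ k

section Nodes

variable {ι J : Type*} [DecidableEq J] {U : Ultrafilter ι} {Ω : Set ℂ} {f : ℂ → ℂ} {k : ℕ}
  {z : ι → J → ℂ} {w : J → ℂ} {T S : Finset J}

theorem NodesTo.mono (h : NodesTo U Ω f k z w T) (hST : S ⊆ T) : NodesTo U Ω f k z w S where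
  injOn := h.injOn.mono fun _ ht => ht.mono (by exact_mod_cast hST)
  mem := h.mem.mono fun _ ht j hj => ht j (hST hj)
  tendsto j hj := h.tendsto j (hST hj)
  bound j hj := h.bound j (hST hj)
  card_le c := (Finset.card_le_card (Finset.filter_subset_filter _ hST)).trans (h.card_le c)

/-- Induction on the number of nodes. If two limits differ, the recursion expresses the divided
difference by shorter ones over a denominator with nonzero limit. Otherwise all nodes enter one ball
where the local bound holds; `card_le` ensures that there are at most k of them. -/
theorem NodesTo.exists_tendsto_nodeDiff (h : NodesTo U Ω f k z w T) :
    ∃ l, Tendsto (fun t => nodeDiff f T (z t)) U (𝓝 l) := by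
  induction hn : T.card generalizing T with
  | zero =>
    rw [Finset.card_eq_zero] at hn
    subst hn
    exact ⟨0, by simp⟩
  | succ n ih =>
    by_cases hab : ∃ a ∈ T, ∃ b ∈ T, w a ≠ w b
    · obtain ⟨a, ha, b, hb, hne⟩ := hab
      obtain ⟨la, hla⟩ := ih (h.mono (Finset.erase_subset a T))
        (by rw [Finset.card_erase_of_mem ha, hn]; rfl)
      obtain ⟨lb, hlb⟩ := ih (h.mono (Finset.erase_subset b T))
        (by rw [Finset.card_erase_of_mem hb, hn]; rfl)
      refine ⟨(lb - la) / (w a - w b), Tendsto.congr' ?_ ((hlb.sub hla).div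
        ((h.tendsto a ha).sub (h.tendsto b hb)) (sub_ne_zero.2 hne))⟩
      filter_upwards [h.injOn] with t ht
      have hab : a ≠ b := fun e => hne (by rw [e])
      have h0 : z t a - z t b ≠ 0 := sub_ne_zero.2 fun e => hab (ht ha hb e)
      simp only [Pi.div_apply]
      rw [← sub_mul_nodeDiff ht ha hb hab]
      field_simp
    · push Not at hab
      obtain ⟨a, ha⟩ : T.Nonempty := Finset.card_pos.1 (by omega)
      have hfil : (T.filter fun j => w j = w a) = T :=
        Finset.filter_true_of_mem fun j hj => hab j hj a ha
      have hk := h.card_le (w a)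
      rw [hfil] at hk
      obtain ⟨ε, hε, M, -, hM⟩ := h.bound a ha
      refine exists_tendsto_of_bounded U (M := M) ?_
      have hball : ∀ᶠ t in (U : Filter ι), ∀ j ∈ T, z t j ∈ Metric.closedBall (w a) ε := by
        rw [Filter.eventually_all_finset]
        intro j hj
        have := h.tendsto j hj
        rw [hab j hj a ha] at this
        exact this (Metric.closedBall_mem_nhds _ hε)
      filter_upwards [h.injOn, h.mem, hball] with t h1 h2 h3
      rw [← nodeDiff_image h1]
      refine hM _ hk _ ?_ (Finset.card_image_of_injOn h1)
      intro x hx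
      obtain ⟨j, hj, rfl⟩ := Finset.mem_image.1 (Finset.mem_coe.1 hx)
      exact ⟨h2 j hj, h3 j hj⟩

end Nodes

/-! ### Limits of polynomials -/

/-- Convergence of polynomials, pointwise and as functions of convergent matrices. -/
def PolyLim {ι : Type*} (U : Filter ι) (p : ι → ℂ[X]) (P : ℂ[X]) : Prop :=
  (∀ x, Tendsto (fun t => (p t).eval x) U (𝓝 (P.eval x))) ∧
    ∀ {n : ℕ} (A : ι → Matrix (Fin n) (Fin n) ℂ) (B : Matrix (Fin n) (Fin n) ℂ),
      Tendsto A U (𝓝 B) → Tendsto (fun t => aeval (A t) (p t)) U (𝓝 (aeval B P))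

section PolyLim

variable {ι : Type*} {U : Filter ι} {p q : ι → ℂ[X]} {P Q : ℂ[X]}

theorem PolyLim.const (P : ℂ[X]) : PolyLim U (fun _ => P) P :=
  ⟨fun _ => tendsto_const_nhds, fun {n} A B h => by
    have hc : Continuous fun B : Matrix (Fin n) (Fin n) ℂ => aeval B P :=
      Polynomial.continuous_aeval P
    exact (hc.tendsto B).comp h⟩

theorem PolyLim.add (hp : PolyLim U p P) (hq : PolyLim U q Q) :
    PolyLim U (fun t => p t + q t) (P + Q) :=
  ⟨fun x => by simpa using (hp.1 x).add (hq.1 x), fun A B h => by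
    simpa using (hp.2 A B h).add (hq.2 A B h)⟩

theorem PolyLim.mul (hp : PolyLim U p P) (hq : PolyLim U q Q) :
    PolyLim U (fun t => p t * q t) (P * Q) :=
  ⟨fun x => by simpa using (hp.1 x).mul (hq.1 x), fun A B h => by
    simpa using (hp.2 A B h).mul (hq.2 A B h)⟩

theorem PolyLim.C {g : ι → ℂ} {l : ℂ} (h : Tendsto g U (𝓝 l)) :
    PolyLim U (fun t => C (g t)) (C l) :=
  ⟨fun x => by simpa using h, fun A B _ => by
    simp only [aeval_C, Algebra.algebraMap_eq_smul_one]
    exact h.smul_const _⟩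

theorem PolyLim.nodal {J : Type*} {z : ι → J → ℂ} {w : J → ℂ} (T : Finset J)
    (h : ∀ j ∈ T, Tendsto (fun t => z t j) U (𝓝 (w j))) :
    PolyLim U (fun t => Lagrange.nodal T (z t)) (Lagrange.nodal T w) := by
  classical
  induction T using Finset.induction_on with
  | empty => simpa using PolyLim.const 1
  | insert a T ha ih =>
    simp only [Lagrange.nodal_insert_eq_nodal ha]
    refine PolyLim.mul ?_ (ih fun j hj => h j (Finset.mem_insert_of_mem hj))
    have := (PolyLim.const (U := U) X).add (PolyLim.C (h a (Finset.mem_insert_self a T)).neg)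
    simpa [sub_eq_add_neg] using this

theorem PolyLim.congr' (h : PolyLim U p P) (hpq : p =ᶠ[U] q) : PolyLim U q P :=
  ⟨fun x => (h.1 x).congr' (hpq.mono fun t ht => by simp only [ht]),
    fun A B hA => (h.2 A B hA).congr' (hpq.mono fun t ht => by simp only [ht])⟩

theorem PolyLim.unique [U.NeBot] (h : PolyLim U p P) (h' : PolyLim U p Q) : P = Q :=
  Polynomial.funext fun x => tendsto_nhds_unique (h.1 x) (h'.1 x)

/-- A polynomial of degree below m is recovered from its values at 0, …, m-1 by a fixed Lagrange
formula, and this formula passes to the limit. -/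
theorem PolyLim.degree_lt [U.NeBot] {m : ℕ} (h : PolyLim U p P)
    (hp : ∀ᶠ t in U, (p t).degree < m) : P.degree < m := by
  classical
  let v : Fin m → ℂ := fun i => (i : ℂ)
  have hv : Set.InjOn v (Finset.univ : Finset (Fin m)) := fun i _ j _ hij =>
    Fin.ext (Nat.cast_injective (R := ℂ) hij)
  have hP : P = Lagrange.interpolate Finset.univ v fun i => P.eval (v i) := by
    refine Polynomial.funext fun x => tendsto_nhds_unique (h.1 x) ?_
    have h1 : Tendsto (fun t => ∑ i, (p t).eval (v i) * (Lagrange.basis Finset.univ v i).eval x) U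
        (𝓝 (∑ i, P.eval (v i) * (Lagrange.basis Finset.univ v i).eval x)) :=
      tendsto_finsetSum _ fun i _ => (h.1 (v i)).mul_const _
    rw [Lagrange.interpolate_apply, eval_finsetSum]
    simp only [eval_mul, eval_C]
    refine h1.congr' (hp.mono fun t ht => ?_)
    have := Lagrange.eq_interpolate (f := p t) hv (by simpa using ht)
    conv_rhs => simp only []; rw [this]
    rw [Lagrange.interpolate_apply, eval_finsetSum]
    simp
  rw [hP]
  simpa using Lagrange.degree_interpolate_lt (s := Finset.univ) (fun i => P.eval (v i)) hv

end PolyLim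

/-! ### Limits of interpolation polynomials -/

section Nodes

variable {ι J : Type*} [DecidableEq J] {U : Ultrafilter ι} {Ω : Set ℂ} {f : ℂ → ℂ} {k : ℕ}
  {z : ι → J → ℂ} {w : J → ℂ} {T S : Finset J}

/-- Add the nodes outside `S` one at a time: every Newton term has a convergent coefficient and
contains the nodal polynomial of `S`. With `S` empty this gives convergence of the interpolation
polynomials; with `S` the nodes tending to c, it determines the limit modulo a power of X-c. -/
theorem NodesTo.exists_quotient (h : NodesTo U Ω f k z w T) (hST : S ⊆ T) :
    ∃ (R : ι → ℂ[X]) (Q : ℂ[X]), PolyLim U R Q ∧ ∀ᶠ t in (U : Filter ι),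
      interp f T (z t) = interp f S (z t) + R t * Lagrange.nodal S (z t) := by
  obtain ⟨D, rfl⟩ : ∃ D, T = D ∪ S := ⟨T, (Finset.union_eq_left.2 hST).symm⟩
  clear hST
  induction D using Finset.induction_on with
  | empty => exact ⟨0, 0, PolyLim.const 0, by simp⟩
  | insert a D ha ih =>
    obtain ⟨R, Q, hRQ, hev⟩ := ih
      (h.mono (Finset.union_subset_union_left (Finset.subset_insert a D)))
    rw [Finset.insert_union] at h ⊢
    by_cases haS : a ∈ D ∪ S
    · rw [Finset.insert_eq_of_mem haS]
      exact ⟨R, Q, hRQ, hev⟩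
    obtain ⟨l, hl⟩ := h.exists_tendsto_nodeDiff
    refine ⟨fun t => R t + C (nodeDiff f (insert a (D ∪ S)) (z t)) *
      Lagrange.nodal ((D ∪ S) \ S) (z t), _, hRQ.add ((PolyLim.C hl).mul
        (PolyLim.nodal (w := w) _ fun j hj => h.tendsto j
          (Finset.mem_insert_of_mem (Finset.sdiff_subset hj)))), ?_⟩
    filter_upwards [hev, h.injOn] with t h1 h2
    have hsplit : Lagrange.nodal (D ∪ S) (z t) =
        Lagrange.nodal ((D ∪ S) \ S) (z t) * Lagrange.nodal S (z t) :=
      (Finset.prod_sdiff Finset.subset_union_right).symm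
    rw [interp_insert haS h2, h1, hsplit]
    ring

theorem NodesTo.exists_polyLim (h : NodesTo U Ω f k z w T) :
    ∃ P, PolyLim U (fun t => interp f T (z t)) P ∧ P.degree < T.card := by
  obtain ⟨R, Q, hRQ, hev⟩ := h.exists_quotient (Finset.empty_subset T)
  have : PolyLim U (fun t => interp f T (z t)) Q :=
    hRQ.congr' (hev.mono fun t ht => by simpa using ht.symm)
  exact ⟨Q, this, this.degree_lt (h.injOn.mono fun t ht => degree_interp_lt ht)⟩

/-- The error of interpolation in the limit, when all nodes tend to the same point. -/
theorem norm_sub_eval_le {c : ℂ} {ε M : ℝ} {P : ℂ[X]}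
    (hb : DiffBound f (Ω ∩ Metric.closedBall c ε) (T.card + 1) M) (hM : 0 ≤ M)
    (hinj : ∀ᶠ t in (U : Filter ι), Set.InjOn (z t) T)
    (hmem : ∀ᶠ t in (U : Filter ι), ∀ j ∈ T, z t j ∈ Ω ∩ Metric.closedBall c ε) {a : ℂ}
    (hlim : ∀ j ∈ T, Tendsto (fun t => z t j) U (𝓝 a))
    (hP : PolyLim U (fun t => interp f T (z t)) P) {x : ℂ}
    (hx : x ∈ Ω ∩ Metric.closedBall c ε) :
    ‖f x - P.eval x‖ ≤ M * ‖x - a‖ ^ T.card := by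
  have h1 : Tendsto (fun t => M * ‖∏ j ∈ T, (x - z t j)‖) U (𝓝 (M * ‖∏ j ∈ T, (x - a)‖)) :=
    (tendsto_finsetProd T fun j hj => tendsto_const_nhds.sub (hlim j hj)).norm.const_mul M
  rw [Finset.prod_const, norm_pow] at h1
  refine le_of_tendsto_of_tendsto ((hP.1 x).const_sub (f x)).norm h1 ?_
  filter_upwards [hinj, hmem] with t h2 h3
  rw [← interp_image h2]
  -- If x is itself a node, the error is zero; otherwise x together with the nodes makes `T.card +
  -- 1` different points, to which the bound applies.
  by_cases hxT : x ∈ T.image (z t)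
  · have := eval_interp (f := f) (s := T.image (z t)) (z := id) Function.injective_id.injOn hxT
    simp only [id] at this
    rw [this]
    simp only [sub_self, norm_zero]
    positivity
  · rw [sub_eval_interp hxT, norm_mul, Finset.prod_image h2]
    refine mul_le_mul_of_nonneg_right (hb _ ?_ ?_) (norm_nonneg _)
    · intro y hy
      rw [Finset.mem_coe, Finset.mem_insert] at hy
      rcases hy with rfl | hy
      · exact hx
      · obtain ⟨j, hj, rfl⟩ := Finset.mem_image.1 hy
        exact h3 j hj
    · rw [Finset.card_insert_of_notMem hxT, Finset.card_image_of_injOn h2]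

end Nodes

/-! ### Taylor expansions -/

theorem exists_taylor (P : ℂ[X]) (a : ℂ) (q : ℕ) : ∃ S : ℂ[X],
    P = (∑ j ∈ Finset.range q, C ((derivative^[j] P).eval a / (j ! : ℂ)) * (X - C a) ^ j) +
      (X - C a) ^ q * S := by
  obtain ⟨S, hS⟩ := dvd_of_derivs (p := q) (c := a)
    (P := P - ∑ j ∈ Finset.range q, C ((derivative^[j] P).eval a / (j ! : ℂ)) * (X - C a) ^ j) (by
      intro s hs
      simp only [iterate_derivative_sub, iterate_derivative_sum, eval_sub, eval_finsetSum,
        iterate_derivative_C_mul, iterate_derivative_X_sub_pow]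
      rw [Finset.sum_eq_single s]
      · have hf : (s ! : ℂ) ≠ 0 := by exact_mod_cast s.factorial_ne_zero
        simp [Nat.descFactorial_self]
        field_simp
        simp
      · intro i hi his
        rcases lt_or_gt_of_ne his with h | h
        · simp [Nat.descFactorial_of_lt h]
        · have : i - s ≠ 0 := by omega
          simp [this]
      · intro h
        exact absurd (Finset.mem_range.2 hs) h)
  exact ⟨S, by rw [← hS]; ring⟩

/-- A polynomial that approximates `f` to the order `q` at `a` gives the T-derivatives. -/
theorem exists_isTaylorAt {Ω : Set ℂ} {f : ℂ → ℂ} {a : ℂ} {q : ℕ} {P : ℂ[X]} {ε M : ℝ}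
    (ha : a ∈ Ω) (hε : 0 < ε)
    (h : ∀ x ∈ Ω, ‖x - a‖ ≤ ε → ‖f x - P.eval x‖ ≤ M * ‖x - a‖ ^ (q + 1)) :
    ∃ τ, IsTaylorAt Ω f q a (fun j => (derivative^[j] P).eval a) τ := by
  obtain ⟨S, hS⟩ := exists_taylor P a (q + 1)
  have hfa : f a = P.eval a := by
    have := h a ha (by simpa using hε.le)
    simpa [sub_eq_zero] using this
  set T : ℂ → ℂ := fun z => ∑ j ∈ Finset.range (q + 1),
    (derivative^[j] P).eval a / (j ! : ℂ) * (z - a) ^ j with hT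
  have hPT : ∀ z, P.eval z = T z + (z - a) ^ (q + 1) * S.eval z := by
    intro z
    conv_lhs => rw [hS]
    simp [hT, eval_finsetSum]
  -- The last summand absorbs the Taylor terms of `P` of order above q.
  let τ : ℂ → ℂ := fun z => if z = a then 0 else (f z - P.eval z) / (z - a) ^ q +
    (z - a) * S.eval z
  refine ⟨τ, fun z hz => ?_, by simp [τ], ?_⟩
  · change f z = T z + τ z * (z - a) ^ q
    by_cases hza : z = a
    · subst hza
      rw [hfa, hPT z]
      simp [τ]
    · have h0 : (z - a) ^ q ≠ 0 := pow_ne_zero _ (sub_ne_zero.2 hza)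
      simp only [τ, if_neg hza]
      rw [add_mul, div_mul_cancel₀ _ h0, hPT z]
      ring
  · have hb : Tendsto (fun z => |M| * ‖z - a‖ + ‖(z - a) * S.eval z‖) (𝓝[Ω] a) (𝓝 0) := by
      have hc : Continuous fun z : ℂ => |M| * ‖z - a‖ + ‖(z - a) * S.eval z‖ := by fun_prop
      have := (hc.tendsto a).mono_left (nhdsWithin_le_nhds (s := Ω))
      simpa using this
    have hτa : τ a = 0 := by simp [τ]
    rw [ContinuousWithinAt, hτa]
    refine squeeze_zero_norm' ?_ hb
    have hmem : Metric.closedBall a ε ∈ 𝓝[Ω] a :=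
      mem_nhdsWithin_of_mem_nhds (Metric.closedBall_mem_nhds a hε)
    filter_upwards [self_mem_nhdsWithin, hmem] with z hz hzε
    by_cases hza : z = a
    · subst hza; simp [τ]
    · simp only [τ, if_neg hza]
      refine (norm_add_le _ _).trans (add_le_add ?_ le_rfl)
      have h0 : 0 < ‖z - a‖ ^ q := pow_pos (norm_pos_iff.2 (sub_ne_zero.2 hza)) _
      rw [norm_div, norm_pow, div_le_iff₀ h0]
      have := h z hz (by rwa [Metric.mem_closedBall, dist_eq_norm] at hzε)
      refine this.trans ?_
      rw [pow_succ', ← mul_assoc]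
      gcongr
      exact le_abs_self M

theorem tDeriv_eq_of_bound {Ω : Set ℂ} {f : ℂ → ℂ} {a : ℂ} {q : ℕ} {P : ℂ[X]} {ε M : ℝ}
    (ha : a ∈ clusterPts Ω) (hε : 0 < ε)
    (h : ∀ x ∈ Ω, ‖x - a‖ ≤ ε → ‖f x - P.eval x‖ ≤ M * ‖x - a‖ ^ q) :
    ∀ j < q, tDeriv Ω f j a = (derivative^[j] P).eval a := by
  intro j hj
  obtain ⟨q, rfl⟩ : ∃ r, q = r + 1 := ⟨q - 1, by omega⟩
  obtain ⟨τ, hτ⟩ := exists_isTaylorAt ha.1 hε h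
  exact tDeriv_eq ha hτ j (by omega)

/-- The limits of interpolation polynomials are Hermite interpolation polynomials. -/
theorem NodesTo.exists_hermite {ι J : Type*} [DecidableEq J] {U : Ultrafilter ι} {Ω : Set ℂ}
    {f : ℂ → ℂ} {k : ℕ} {z : ι → J → ℂ} {w : J → ℂ} {T : Finset J} (h : NodesTo U Ω f k z w T)
    (hw : ∀ j ∈ T, w j ∈ Ω) (hcard : ∀ c, (T.filter fun j => w j = c).card + 1 ≤ k) :
    ∃ P, PolyLim U (fun t => interp f T (z t)) P ∧ ∀ j ∈ T, P.eval (w j) = f (w j) ∧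
      (w j ∈ clusterPts Ω → ∀ s < (T.filter fun i => w i = w j).card,
        (derivative^[s] P).eval (w j) = tDeriv Ω f s (w j)) := by
  obtain ⟨P, hP, -⟩ := h.exists_polyLim
  refine ⟨P, hP, fun j hj => ?_⟩
  set c := w j with hc
  set S := T.filter fun i => w i = c with hS
  have hST : S ⊆ T := Finset.filter_subset _ _
  have hjS : j ∈ S := Finset.mem_filter.2 ⟨hj, rfl⟩
  have hSpos : 0 < S.card := Finset.card_pos.2 ⟨j, hjS⟩
  obtain ⟨R, Q, hRQ, hev⟩ := h.exists_quotient hST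
  obtain ⟨PS, hPS, -⟩ := (h.mono hST).exists_polyLim
  have hlim : ∀ i ∈ S, Tendsto (fun t => z t i) U (𝓝 c) := fun i hi => by
    have := h.tendsto i (hST hi)
    rwa [(Finset.mem_filter.1 hi).2] at this
  have hnod : Lagrange.nodal S w = (X - C c) ^ S.card := by
    rw [Lagrange.nodal, Finset.prod_congr rfl fun i hi => by rw [(Finset.mem_filter.1 hi).2],
      Finset.prod_const]
  -- The nodes tending elsewhere change the limit only by a multiple of (X-c)^|S|, so they do not
  -- affect its derivatives at c below order |S|.
  have hPeq : P = PS + Q * (X - C c) ^ S.card := by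
    have h2 := hPS.add (hRQ.mul (PolyLim.nodal (w := w) S fun i hi => h.tendsto i (hST hi)))
    rw [hnod] at h2
    exact (hP.congr' hev).unique h2
  obtain ⟨ε, hε, M, hM, hb⟩ := h.bound j hj
  have hmem : ∀ᶠ t in (U : Filter ι), ∀ i ∈ S, z t i ∈ Ω ∩ Metric.closedBall c ε := by
    have hball : ∀ᶠ t in (U : Filter ι), ∀ i ∈ S, z t i ∈ Metric.closedBall c ε := by
      rw [Filter.eventually_all_finset]
      exact fun i hi => hlim i hi (Metric.closedBall_mem_nhds _ hε)
    filter_upwards [(h.mono hST).mem, hball] with t h1 h2 i hi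
    exact ⟨h1 i hi, h2 i hi⟩
  -- The error formula involves one point more than the nodes; hence the `+ 1` in `hcard`.
  have hest : ∀ x ∈ Ω, ‖x - c‖ ≤ ε → ‖f x - PS.eval x‖ ≤ M * ‖x - c‖ ^ S.card :=
    fun x hx hxc => norm_sub_eval_le (hb _ (hcard c)) hM.le (h.mono hST).injOn hmem hlim hPS
      ⟨hx, by rwa [Metric.mem_closedBall, dist_eq_norm]⟩
  have hder : ∀ s < S.card, (derivative^[s] P).eval c = (derivative^[s] PS).eval c := by
    intro s hs
    rw [← sub_eq_zero, ← eval_sub, ← iterate_derivative_sub]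
    exact derivs_of_dvd ⟨Q, by rw [hPeq]; ring⟩ s hs
  constructor
  · have h1 := hder 0 hSpos
    have h2 := hest c (hw j hj) (by simpa using hε.le)
    rw [sub_self, norm_zero, zero_pow hSpos.ne', mul_zero, norm_le_zero_iff, sub_eq_zero] at h2
    rw [h2]
    simpa using h1
  · intro hcl s hs
    rw [hder s hs, tDeriv_eq_of_bound hcl hε hest s hs]

/-! ### Different points of `Ω` near given points -/

theorem exists_near_notMem {Ω : Set ℂ} {c : ℂ} (hc : c ∈ clusterPts Ω) {F : Set ℂ} (hF : F.Finite)
    {η : ℝ} (hη : 0 < η) : ∃ x ∈ Ω, ‖x - c‖ < η ∧ x ∉ F := by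
  have h1 : Metric.ball c η ∩ (F \ {c})ᶜ ∈ 𝓝 c :=
    inter_mem (Metric.ball_mem_nhds c hη)
      ((hF.subset Set.sdiff_subset).isClosed.isOpen_compl.mem_nhds (by simp))
  obtain ⟨x, ⟨hx1, hx2⟩, hx3, hx4⟩ := mem_closure_iff_nhds.1 hc.2 _ h1
  exact ⟨x, hx3, by rwa [← dist_eq_norm], fun hxF => hx2 ⟨hxF, hx4⟩⟩

theorem exists_injective_near {J : Type*} [Fintype J] {Ω : Set ℂ} {w : J → ℂ} (hw : ∀ j, w j ∈ Ω)
    (hmult : ∀ i j, i ≠ j → w i = w j → w i ∈ clusterPts Ω) {η : ℝ} (hη : 0 < η) :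
    ∃ y : J → ℂ, Function.Injective y ∧ (∀ j, y j ∈ Ω) ∧ ∀ j, ‖y j - w j‖ < η := by
  classical
  -- Points are moved one by one. Isolated ones stay put and moved ones avoid all of `Set.range w`,
  -- so a moved point never collides with an isolated one. Two isolated ones differ by `hmult`.
  have main : ∀ s : Finset J, ∃ y : J → ℂ, (∀ j, y j ∈ Ω) ∧ (∀ j, ‖y j - w j‖ < η) ∧
      (∀ j, w j ∉ clusterPts Ω → y j = w j) ∧ Set.InjOn y s ∧
      ∀ j ∈ s, w j ∈ clusterPts Ω → y j ∉ Set.range w := by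
    intro s
    induction s using Finset.induction_on with
    | empty => exact ⟨w, hw, by simpa using fun _ => hη, by simp, by simp, by simp⟩
    | insert a s ha ih =>
      obtain ⟨y, hy1, hy2, hy3, hy4, hy5⟩ := ih
      by_cases hac : w a ∈ clusterPts Ω
      · obtain ⟨x, hxΩ, hxη, hxF⟩ := exists_near_notMem hac
          (F := (s.image y : Set ℂ) ∪ Set.range w)
          ((Finset.finite_toSet _).union (Set.finite_range w)) hη
        simp only [Set.mem_union, not_or] at hxF
        have hne : ∀ j ∈ s, j ≠ a := fun j hj e => ha (e ▸ hj)
        refine ⟨Function.update y a x, fun j => ?_, fun j => ?_, fun j hj => ?_, ?_, ?_⟩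
        · by_cases hja : j = a
          · subst hja; simpa using hxΩ
          · simpa [hja] using hy1 j
        · by_cases hja : j = a
          · subst hja; simpa using hxη
          · simpa [hja] using hy2 j
        · have hja : j ≠ a := fun e => hj (e ▸ hac)
          simpa [hja] using hy3 j hj
        · rw [Finset.coe_insert, Set.injOn_insert (by simpa using ha)]
          refine ⟨fun i hi j hj hij => ?_, ?_⟩
          · rw [Function.update_of_ne (hne i hi), Function.update_of_ne (hne j hj)] at hij
            exact hy4 hi hj hij
          · rintro ⟨j, hj, hjx⟩
            rw [Function.update_of_ne (hne j hj), Function.update_self] at hjx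
            exact hxF.1 (Finset.mem_coe.2 (Finset.mem_image.2 ⟨j, hj, hjx⟩))
        · intro j hj hjc
          rcases Finset.mem_insert.1 hj with rfl | hj
          · simpa using hxF.2
          · rw [Function.update_of_ne (hne j hj)]
            exact hy5 j hj hjc
      · refine ⟨y, hy1, hy2, hy3, ?_, ?_⟩
        · rw [Finset.coe_insert, Set.injOn_insert (by simpa using ha)]
          refine ⟨hy4, ?_⟩
          rintro ⟨j, hj, hja⟩
          rw [hy3 a hac] at hja
          by_cases hjc : w j ∈ clusterPts Ω
          · exact hy5 j hj hjc ⟨a, hja.symm⟩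
          · rw [hy3 j hjc] at hja
            exact hjc (hmult j a (fun e => ha (e ▸ hj)) hja)
        · intro j hj hjc
          rcases Finset.mem_insert.1 hj with rfl | hj
          · exact absurd hjc hac
          · exact hy5 j hj hjc
  obtain ⟨y, h1, h2, -, h4, -⟩ := main Finset.univ
  exact ⟨y, by simpa [Set.injOn_univ] using h4, h1, h2⟩

theorem tendsto_of_norm_sub_lt {J : Type*} {y : ℕ → J → ℂ} {w : J → ℂ}
    (h : ∀ n j, ‖y n j - w j‖ < 1 / ((n : ℝ) + 1)) (j : J) :
    Tendsto (fun n => y n j) (hyperfilter ℕ : Filter ℕ) (𝓝 (w j)) := by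
  rw [tendsto_iff_norm_sub_tendsto_zero]
  exact (squeeze_zero (fun n => norm_nonneg _) (fun n => (h n j).le)
    tendsto_one_div_add_atTop_nhds_zero_nat).mono_left Nat.hyperfilter_le_atTop

theorem exists_seq_injective {J : Type*} [Fintype J] {Ω : Set ℂ} {w : J → ℂ} (hw : ∀ j, w j ∈ Ω)
    (hmult : ∀ i j, i ≠ j → w i = w j → w i ∈ clusterPts Ω) :
    ∃ y : ℕ → J → ℂ, (∀ n, Function.Injective (y n)) ∧ (∀ n j, y n j ∈ Ω) ∧
      ∀ n j, ‖y n j - w j‖ < 1 / ((n : ℝ) + 1) := by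
  choose y hy using fun n : ℕ => exists_injective_near hw hmult (η := 1 / ((n : ℝ) + 1))
    (by positivity)
  exact ⟨y, fun n => (hy n).1, fun n => (hy n).2.1, fun n => (hy n).2.2⟩

/-! ### Bounded divided differences and the classes `TC` -/

theorem LocDiffBound.lipschitz {Ω : Set ℂ} {f : ℂ → ℂ} {k : ℕ} {c : ℂ} (hk : 2 ≤ k)
    (h : LocDiffBound Ω f k c) : ∃ ε > (0 : ℝ), ∃ M > (0 : ℝ), ∀ x ∈ Ω ∩ Metric.closedBall c ε,
      ∀ y ∈ Ω ∩ Metric.closedBall c ε, ‖f x - f y‖ ≤ M * ‖x - y‖ := by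
  obtain ⟨ε, hε, M, hM, hb⟩ := h
  refine ⟨ε, hε, M, hM, fun x hx y hy => ?_⟩
  by_cases hxy : x = y
  · simp [hxy]
  have h1 := hb 2 hk {x, y} (by
    rw [Finset.coe_insert, Finset.coe_singleton]
    exact Set.insert_subset hx (Set.singleton_subset_iff.2 hy)) (Finset.card_pair hxy)
  have h2 := sub_mul_nodeDiff (f := f) (z := id) (s := {x, y}) Function.injective_id.injOn
    (Finset.mem_insert_self x _) (Finset.mem_insert_of_mem (Finset.mem_singleton_self y)) hxy
  have e1 : ({x, y} : Finset ℂ).erase x = {y} := Finset.erase_insert (by simpa using hxy)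
  have e2 : ({x, y} : Finset ℂ).erase y = {x} := by
    rw [Finset.pair_comm]; exact Finset.erase_insert (by simpa using Ne.symm hxy)
  rw [e1, e2, nodeDiff_singleton, nodeDiff_singleton] at h2
  simp only [id] at h2
  change ‖f x - f y‖ ≤ _
  rw [← h2, norm_mul, mul_comm]
  exact mul_le_mul_of_nonneg_right h1 (norm_nonneg _)

theorem continuousOn_of_locDiffBound {Ω : Set ℂ} {f : ℂ → ℂ} {k : ℕ} (hk : 2 ≤ k)
    (h : ∀ c ∈ Ω, LocDiffBound Ω f k c) : ContinuousOn f Ω := by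
  intro c hc
  obtain ⟨ε, hε, M, -, hL⟩ := (h c hc).lipschitz hk
  rw [ContinuousWithinAt, tendsto_iff_norm_sub_tendsto_zero]
  have hlim : Tendsto (fun x => M * ‖x - c‖) (𝓝[Ω] c) (𝓝 0) := by
    have hcont : Continuous fun x : ℂ => M * ‖x - c‖ := by fun_prop
    simpa using (hcont.tendsto c).mono_left (nhdsWithin_le_nhds (s := Ω))
  refine squeeze_zero' (Eventually.of_forall fun _ => norm_nonneg _) ?_ hlim
  filter_upwards [self_mem_nhdsWithin,
    mem_nhdsWithin_of_mem_nhds (Metric.closedBall_mem_nhds c hε)] with x hx hxε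
  exact hL x ⟨hx, hxε⟩ c ⟨hc, Metric.mem_closedBall_self hε.le⟩

theorem LocDiffBound.of_ball {Ω : Set ℂ} {f : ℂ → ℂ} {k : ℕ} {c a : ℂ} {ε M : ℝ} (hM : 0 < M)
    (h : ∀ m ≤ k, DiffBound f (Ω ∩ Metric.closedBall c ε) m M) (ha : ‖a - c‖ < ε) :
    LocDiffBound Ω f k a := by
  refine ⟨ε - ‖a - c‖, by linarith, M, hM, fun m hm => (h m hm).mono ?_ le_rfl⟩
  refine Set.inter_subset_inter_right _ (Metric.closedBall_subset_closedBall' ?_)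
  rw [dist_eq_norm]
  linarith

/-- The Taylor polynomial of `f` at `a` of order `n`. -/
def taylorPoly (Ω : Set ℂ) (f : ℂ → ℂ) (n : ℕ) (a : ℂ) : ℂ[X] :=
  ∑ j ∈ Finset.range (n + 1), C (tDeriv Ω f j a / (j ! : ℂ)) * (X - C a) ^ j

theorem eval_taylorPoly (Ω : Set ℂ) (f : ℂ → ℂ) (n : ℕ) (a x : ℂ) :
    (taylorPoly Ω f n a).eval x =
      ∑ j ∈ Finset.range (n + 1), tDeriv Ω f j a / (j ! : ℂ) * (x - a) ^ j := by
  simp [taylorPoly, eval_finsetSum]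

theorem degree_taylor_lt (g : ℕ → ℂ) (n : ℕ) (a : ℂ) :
    (∑ j ∈ Finset.range n, C (g j) * (X - C a) ^ j).degree < (n : WithBot ℕ) := by
  rw [← mem_degreeLT]
  refine Submodule.sum_mem _ fun j hj => ?_
  rw [mem_degreeLT]
  have h1 : (C (g j) * (X - C a) ^ j).degree ≤ (j : WithBot ℕ) := by
    rw [← smul_eq_C_mul]
    refine (degree_smul_le _ _).trans ?_
    rw [degree_pow, degree_X_sub_C]
    simp
  exact h1.trans_lt (by exact_mod_cast Finset.mem_range.1 hj)

/-- The remainder of the Taylor expansion, uniformly near a point. -/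
theorem norm_sub_taylorPoly_le {Ω : Set ℂ} {f : ℂ → ℂ} {n : ℕ} {c a : ℂ} {ε M : ℝ} (hM : 0 < M)
    (h : ∀ m ≤ n + 2, DiffBound f (Ω ∩ Metric.closedBall c ε) m M) (ha : a ∈ clusterPts Ω)
    (hac : ‖a - c‖ < ε) {x : ℂ} (hx : x ∈ Ω ∩ Metric.closedBall c ε) :
    ‖f x - (taylorPoly Ω f n a).eval x‖ ≤ M * ‖x - a‖ ^ (n + 1) := by
  obtain ⟨y, hy1, hy2, hy3⟩ := exists_seq_injective (J := Fin (n + 1)) (w := fun _ => a)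
    (fun _ => ha.1) (fun _ _ _ _ => ha)
  have hlim := tendsto_of_norm_sub_lt hy3
  have hN : NodesTo (hyperfilter ℕ) Ω f (n + 2) y (fun _ => a) Finset.univ :=
    { injOn := Eventually.of_forall fun t => (hy1 t).injOn
      mem := Eventually.of_forall fun t j _ => hy2 t j
      tendsto := fun j _ => hlim j
      bound := fun _ _ => LocDiffBound.of_ball hM h hac
      card_le := fun b => (Finset.card_le_univ _).trans (by simp) }
  obtain ⟨P, hP, hdeg⟩ := hN.exists_polyLim
  rw [Finset.card_fin] at hdeg
  have hball : ∀ᶠ t in (hyperfilter ℕ : Filter ℕ), ∀ j ∈ (Finset.univ : Finset (Fin (n + 1))),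
      y t j ∈ Ω ∩ Metric.closedBall c ε := by
    rw [Filter.eventually_all_finset]
    intro j _
    have hm : Metric.closedBall c ε ∈ 𝓝 a :=
      mem_of_superset (Metric.isOpen_ball.mem_nhds
        (by rwa [Metric.mem_ball, dist_eq_norm])) Metric.ball_subset_closedBall
    filter_upwards [hlim j hm] with t ht
    exact ⟨hy2 t j, ht⟩
  have hest : ∀ x ∈ Ω ∩ Metric.closedBall c ε, ‖f x - P.eval x‖ ≤ M * ‖x - a‖ ^ (n + 1) := by
    intro x hx
    have := norm_sub_eval_le (T := Finset.univ) (h _ (by simp)) hM.le hN.injOn hball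
      (fun j _ => hlim j) hP hx
    rwa [Finset.card_fin] at this
  have hder : ∀ j < n + 1, tDeriv Ω f j a = (derivative^[j] P).eval a := by
    refine tDeriv_eq_of_bound (M := M) ha (sub_pos.2 hac) fun x hx hxa => hest x ⟨hx, ?_⟩
    rw [Metric.mem_closedBall, dist_eq_norm]
    have := norm_add_le (x - a) (a - c)
    rw [sub_add_sub_cancel] at this
    linarith
  -- A polynomial of degree at most n equals its own Taylor polynomial of order n, and the
  -- coefficients are already known to be the T-derivatives.
  have hPT : P = taylorPoly Ω f n a := by
    obtain ⟨S, hS⟩ := exists_taylor P a (n + 1)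
    have hsum : (∑ j ∈ Finset.range (n + 1),
        C ((derivative^[j] P).eval a / (j ! : ℂ)) * (X - C a) ^ j) = taylorPoly Ω f n a :=
      Finset.sum_congr rfl fun j hj => by rw [hder j (Finset.mem_range.1 hj)]
    rw [hsum] at hS
    rw [← sub_eq_zero]
    refine eq_zero_of_dvd_of_degree_lt (p := (X - C a) ^ (n + 1)) ⟨S, ?_⟩ ?_
    · rw [← sub_eq_iff_eq_add'] at hS; exact hS
    · rw [degree_pow, degree_X_sub_C, nsmul_one, ← mem_degreeLT]
      exact Submodule.sub_mem _ (mem_degreeLT.2 hdeg) (mem_degreeLT.2 (degree_taylor_lt _ _ _))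
  rw [← hPT]
  exact hest x hx

theorem eval_derivative_taylorPoly {Ω : Set ℂ} {f : ℂ → ℂ} {n : ℕ} {a : ℂ} {j : ℕ} (hj : j ≤ n) :
    (derivative^[j] (taylorPoly Ω f n a)).eval a = tDeriv Ω f j a := by
  simp only [taylorPoly, iterate_derivative_sum, eval_finsetSum, iterate_derivative_C_mul,
    iterate_derivative_X_sub_pow]
  rw [Finset.sum_eq_single j]
  · have hf : (j ! : ℂ) ≠ 0 := by exact_mod_cast j.factorial_ne_zero
    simp [Nat.descFactorial_self]
    field_simp
  · intro i hi his
    rcases lt_or_gt_of_ne his with h | h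
    · simp [Nat.descFactorial_of_lt h]
    · have : i - j ≠ 0 := by omega
      simp [this]
  · intro h
    exact absurd (Finset.mem_range.2 (by omega)) h

/-- As a → c along an ultrafilter, the Taylor polynomials at a have degree at most n and stay
bounded at n+1 fixed points, so they converge to some `Q`. The uniform remainder estimate passes to
the limit and identifies the derivatives of `Q` at c as the T-derivatives. -/
theorem continuousOn_tDeriv {Ω : Set ℂ} {f : ℂ → ℂ} {n : ℕ}
    (h : ∀ c ∈ Ω, LocDiffBound Ω f (n + 2) c) {j : ℕ} (hj : j ≤ n) :
    ContinuousOn (tDeriv Ω f j) (clusterPts Ω) := by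
  intro c hc
  obtain ⟨ε, hε, M, hM, hb⟩ := h c hc.1
  rw [ContinuousWithinAt, tendsto_iff_ultrafilter]
  intro U hU
  have hUc : Tendsto (fun a : ℂ => a) (U : Filter ℂ) (𝓝 c) := hU.trans nhdsWithin_le_nhds
  have hUcl : ∀ᶠ a in (U : Filter ℂ), a ∈ clusterPts Ω := hU self_mem_nhdsWithin
  have hUε : ∀ᶠ a in (U : Filter ℂ), ‖a - c‖ < ε := by
    have := hUc (Metric.ball_mem_nhds c hε)
    filter_upwards [this] with a ha
    rwa [← dist_eq_norm]
  obtain ⟨x, hxinj, hxΩ, hxc⟩ := exists_injective_near (J := Fin (n + 1)) (w := fun _ => c)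
    (fun _ => hc.1) (fun _ _ _ _ => hc) hε
  have hxball : ∀ i, x i ∈ Ω ∩ Metric.closedBall c ε := fun i =>
    ⟨hxΩ i, by rw [Metric.mem_closedBall, dist_eq_norm]; exact (hxc i).le⟩
  let T := taylorPoly Ω f n
  have hval : ∀ i, ∃ v, Tendsto (fun a => (T a).eval (x i)) (U : Filter ℂ) (𝓝 v) := by
    intro i
    refine exists_tendsto_of_bounded U (M := ‖f (x i)‖ + M * (ε + ε) ^ (n + 1)) ?_
    filter_upwards [hUcl, hUε] with a ha haε
    have h1 := norm_sub_taylorPoly_le hM hb ha haε (hxball i)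
    have h2 : ‖x i - a‖ ≤ ε + ε := by
      have := norm_sub_le (x i - c) (a - c)
      rw [sub_sub_sub_cancel_right] at this
      linarith [hxc i]
    have h3 : M * ‖x i - a‖ ^ (n + 1) ≤ M * (ε + ε) ^ (n + 1) := by gcongr
    have h4 := norm_sub_le (f (x i)) (f (x i) - (T a).eval (x i))
    rw [sub_sub_cancel] at h4
    linarith
  choose v hv using hval
  have hxs : Set.InjOn x (Finset.univ : Finset (Fin (n + 1))) := hxinj.injOn
  let B := fun i => Lagrange.basis Finset.univ x i
  let Q : ℂ[X] := ∑ i, C (v i) * B i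
  have hT : ∀ a, T a = ∑ i, C ((T a).eval (x i)) * B i := by
    intro a
    have h1 := Lagrange.eq_interpolate (f := T a) hxs
      (by rw [Finset.card_fin]; exact degree_taylor_lt _ (n + 1) a)
    rwa [Lagrange.interpolate_apply] at h1
  have hTQ : ∀ y, Tendsto (fun a => (T a).eval y) (U : Filter ℂ) (𝓝 (Q.eval y)) := by
    intro y
    have h1 : Tendsto (fun a => ∑ i, (T a).eval (x i) * (B i).eval y) (U : Filter ℂ)
        (𝓝 (∑ i, v i * (B i).eval y)) := tendsto_finsetSum _ fun i _ => (hv i).mul_const _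
    have h2 : Q.eval y = ∑ i, v i * (B i).eval y := by simp [Q, eval_finsetSum]
    rw [h2]
    refine h1.congr fun a => ?_
    conv_rhs => rw [hT a]
    simp [eval_finsetSum]
  have hQ : ∀ y ∈ Ω, ‖y - c‖ ≤ ε → ‖f y - Q.eval y‖ ≤ M * ‖y - c‖ ^ (n + 1) := by
    intro y hy hyc
    refine le_of_tendsto_of_tendsto ((hTQ y).const_sub (f y)).norm
      (((hUc.const_sub y).norm.pow (n + 1)).const_mul M) ?_
    filter_upwards [hUcl, hUε] with a ha haε
    exact norm_sub_taylorPoly_le hM hb ha haε ⟨hy, by rwa [Metric.mem_closedBall, dist_eq_norm]⟩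
  rw [tDeriv_eq_of_bound hc hε hQ j (by omega)]
  have hder : ∀ (g : Fin (n + 1) → ℂ) (y : ℂ), (derivative^[j] (∑ i, C (g i) * B i)).eval y =
      ∑ i, g i * (derivative^[j] (B i)).eval y := by
    intro g y
    simp only [iterate_derivative_sum, eval_finsetSum, iterate_derivative_C_mul, eval_mul, eval_C]
  -- In the fixed basis `B` only the coefficients and the point of evaluation vary, so derivatives
  -- converge along with values.
  have h1 : Tendsto (fun a => ∑ i, (T a).eval (x i) * (derivative^[j] (B i)).eval a)
      (U : Filter ℂ) (𝓝 (∑ i, v i * (derivative^[j] (B i)).eval c)) :=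
    tendsto_finsetSum _ fun i _ => (hv i).mul
      (((Polynomial.continuous (derivative^[j] (B i))).tendsto c).comp hUc)
  rw [hder]
  refine h1.congr fun a => ?_
  rw [← eval_derivative_taylorPoly hj, ← hder]
  exact congrArg (fun p => (derivative^[j] p).eval a) (hT a).symm

/-- Off the diagonal the remainder is a quotient of continuous functions. At the diagonal it is
continuous because the uniform Taylor estimate has one order to spare and gives |τ a z| ≤ M|z-a|. -/
theorem isTC_of_locDiffBound {Ω : Set ℂ} {f : ℂ → ℂ} {n : ℕ}
    (h : ∀ c ∈ Ω, LocDiffBound Ω f (n + 2) c) : IsTC Ω f n := by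
  have hf : ContinuousOn f Ω := continuousOn_of_locDiffBound (by omega) h
  rcases n with _ | n
  · exact hf
  let T := taylorPoly Ω f (n + 1)
  let τ : ℂ → ℂ → ℂ := fun a z => if z = a then 0 else (f z - (T a).eval z) / (z - a) ^ (n + 1)
  have hbound : ∀ c ∈ clusterPts Ω, ∃ ε > 0, ∃ M, ∀ a ∈ clusterPts Ω, ‖a - c‖ < ε → ∀ z ∈ Ω,
      ‖z - c‖ < ε → ‖τ a z‖ ≤ M * ‖z - a‖ := by
    intro c hc
    obtain ⟨ε, hε, M, hM, hb⟩ := h c hc.1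
    refine ⟨ε, hε, M, fun a ha hac z hz hzc => ?_⟩
    by_cases hza : z = a
    · simp [τ, hza]
    have h0 : 0 < ‖z - a‖ ^ (n + 1) := pow_pos (norm_pos_iff.2 (sub_ne_zero.2 hza)) _
    simp only [τ, if_neg hza]
    rw [norm_div, norm_pow, div_le_iff₀ h0, mul_assoc, ← pow_succ']
    exact norm_sub_taylorPoly_le hM hb ha hac
      ⟨hz, by rw [Metric.mem_closedBall, dist_eq_norm]; exact hzc.le⟩
  have hder : ∀ j ≤ n + 1, ContinuousOn (tDeriv Ω f j) (clusterPts Ω) :=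
    fun j hj => continuousOn_tDeriv h hj
  have hdiag : ∀ a ∈ clusterPts Ω, ContinuousWithinAt (fun p : ℂ × ℂ => τ p.1 p.2)
      (clusterPts Ω ×ˢ Ω) (a, a) := by
    intro a ha
    obtain ⟨ε, hε, M, hM⟩ := hbound a ha
    have hτ : τ a a = 0 := by simp [τ]
    rw [ContinuousWithinAt]
    simp only [hτ]
    have hlim : Tendsto (fun p : ℂ × ℂ => M * ‖p.2 - p.1‖) (𝓝[clusterPts Ω ×ˢ Ω] (a, a))
        (𝓝 0) := by
      have hcont : Continuous fun p : ℂ × ℂ => M * ‖p.2 - p.1‖ := by fun_prop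
      simpa using (hcont.tendsto (a, a)).mono_left (nhdsWithin_le_nhds (s := clusterPts Ω ×ˢ Ω))
    refine squeeze_zero_norm' ?_ hlim
    filter_upwards [self_mem_nhdsWithin, mem_nhdsWithin_of_mem_nhds
      (prod_mem_nhds (Metric.ball_mem_nhds a hε) (Metric.ball_mem_nhds a hε))] with p hp hpε
    exact hM p.1 hp.1 (by rw [← dist_eq_norm]; exact hpε.1) p.2 hp.2
      (by rw [← dist_eq_norm]; exact hpε.2)
  refine ⟨τ, fun a ha => ⟨fun z hz => ?_, by simp [τ], ?_⟩, fun j _ hj => hder j hj, ?_⟩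
  · rw [← eval_taylorPoly]
    by_cases hza : z = a
    · subst hza
      simp only [τ, if_true, zero_mul, add_zero]
      have := eval_derivative_taylorPoly (Ω := Ω) (f := f) (n := n + 1) (a := z) (j := 0)
        (Nat.zero_le _)
      simpa [tDeriv] using this.symm
    · have h0 : (z - a) ^ (n + 1) ≠ 0 := pow_ne_zero _ (sub_ne_zero.2 hza)
      simp only [τ, if_neg hza, T]
      rw [div_mul_cancel₀ _ h0]
      ring
  · exact (hdiag a ha).comp (f := fun z : ℂ => (a, z)) (s := Ω)
      (continuousWithinAt_const.prodMk continuousWithinAt_id) fun z hz => ⟨ha, hz⟩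
  · rintro ⟨a, x⟩ ⟨ha, hx⟩
    by_cases hxa : x = a
    · rw [hxa]; exact hdiag a ha
    have hne : ∀ᶠ p : ℂ × ℂ in 𝓝[clusterPts Ω ×ˢ Ω] (a, x), p.2 ≠ p.1 :=
      mem_nhdsWithin_of_mem_nhds
        ((isOpen_ne_fun continuous_snd continuous_fst).mem_nhds (x := (a, x)) hxa)
    have hfst : ContinuousWithinAt (fun p : ℂ × ℂ => p.1) (clusterPts Ω ×ˢ Ω) (a, x) :=
      continuousWithinAt_fst
    have hsnd : ContinuousWithinAt (fun p : ℂ × ℂ => p.2) (clusterPts Ω ×ˢ Ω) (a, x) :=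
      continuousWithinAt_snd
    have hformula : ContinuousWithinAt (fun p : ℂ × ℂ => (f p.2 -
        ∑ j ∈ Finset.range (n + 1 + 1), tDeriv Ω f j p.1 / (j ! : ℂ) * (p.2 - p.1) ^ j) /
          (p.2 - p.1) ^ (n + 1)) (clusterPts Ω ×ˢ Ω) (a, x) := by
      refine ContinuousWithinAt.div ?_ ((hsnd.sub hfst).pow _)
        (pow_ne_zero _ (sub_ne_zero.2 hxa))
      refine ((hf x hx).comp (f := fun p : ℂ × ℂ => p.2) hsnd fun p hp => hp.2).sub ?_
      refine tendsto_finsetSum _ fun j hj => ?_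
      have h1 : ContinuousWithinAt (fun p : ℂ × ℂ => tDeriv Ω f j p.1) (clusterPts Ω ×ˢ Ω)
          (a, x) := (hder j (by have := Finset.mem_range.1 hj; omega) a ha).comp
            (g := tDeriv Ω f j) (f := fun p : ℂ × ℂ => p.1) hfst fun p hp => hp.1
      exact (h1.div_const _).mul ((hsnd.sub hfst).pow j)
    refine hformula.congr_of_eventuallyEq ?_ ?_
    · filter_upwards [hne] with p hp
      simp only [τ, if_neg hp, T, eval_taylorPoly]
    · simp only [τ, if_neg hxa, T, eval_taylorPoly]

/-! ### Minimal polynomials of matrices -/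

section Minpoly

variable {k : ℕ} {X : Matrix (Fin k) (Fin k) ℂ}

theorem minpoly_ne_zero (X : Matrix (Fin k) (Fin k) ℂ) : minpoly ℂ X ≠ 0 :=
  minpoly.ne_zero (Matrix.isIntegral X)

theorem mem_spectrum_of_isRoot {c : ℂ} (hc : (minpoly ℂ X).IsRoot c) : c ∈ spectrum ℂ X := by
  have := (Module.End.hasEigenvalue_iff_isRoot (f := Matrix.toLin' X) (μ := c)).2 (by
    rwa [Matrix.minpoly_toLin'])
  have := this.mem_spectrum
  rwa [Matrix.spectrum_toLin'] at this

theorem natDegree_minpoly_le (X : Matrix (Fin k) (Fin k) ℂ) : (minpoly ℂ X).natDegree ≤ k := by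
  have h := natDegree_le_of_dvd (Matrix.minpoly_dvd_charpoly X) X.charpoly_monic.ne_zero
  rwa [Matrix.charpoly_natDegree_eq_dim, Fintype.card_fin] at h

theorem exists_nodal_eq {p : ℂ[X]} (hp : p.Monic) {d : ℕ} (hd : p.natDegree = d) :
    ∃ z : Fin d → ℂ, p = Lagrange.nodal Finset.univ z := by
  have hs := IsAlgClosed.splits p
  have hlen : p.roots.toList.length = d := by
    rw [Multiset.length_toList, ← hs.natDegree_eq_card_roots, hd]
  subst hlen
  refine ⟨fun i => p.roots.toList.get i, ?_⟩
  conv_lhs => rw [hs.eq_prod_roots_of_monic hp]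
  rw [Lagrange.nodal_eq, ← List.prod_ofFn]
  conv_lhs => rw [← Multiset.coe_toList p.roots, Multiset.map_coe, Multiset.prod_coe,
    ← List.ofFn_get p.roots.toList, List.map_ofFn]
  rfl

theorem rootMultiplicity_nodal {J : Type*} (T : Finset J) (z : J → ℂ) (c : ℂ)
    [DecidableEq J] :
    (Lagrange.nodal T z).rootMultiplicity c = (T.filter fun j => z j = c).card := by
  have h1 : Lagrange.nodal T z = ((T.val.map z).map fun a => Polynomial.X - C a).prod := by
    rw [Multiset.map_map]; rfl
  rw [← count_roots, h1, roots_multiset_prod_X_sub_C, Multiset.count_map]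
  simp only [Finset.card, Finset.filter_val, eq_comm]

/-- A root of multiplicity k would exhaust the degree, so the minimal polynomial would be (X-c)^k,
which means membership in `singMat`. Outside it, the roots meet the multiplicity limit k-1 of
Hermite interpolation. -/
theorem rootMultiplicity_minpoly_lt (hk : 1 ≤ k) (hX : X ∉ singMat k) (c : ℂ) :
    (minpoly ℂ X).rootMultiplicity c + 1 ≤ k := by
  by_contra hlt
  have hle : k ≤ (minpoly ℂ X).rootMultiplicity c := by omega
  have hdvd : (Polynomial.X - C c) ^ k ∣ minpoly ℂ X :=
    (le_rootMultiplicity_iff (minpoly_ne_zero X)).1 hle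
  have heq : minpoly ℂ X = (Polynomial.X - C c) ^ k := by
    refine (eq_of_monic_of_dvd_of_natDegree_le ((monic_X_sub_C c).pow k)
      (minpoly.monic (Matrix.isIntegral X)) hdvd ?_)
    rw [natDegree_pow, natDegree_X_sub_C, mul_one]
    exact natDegree_minpoly_le X
  have hpow : ∀ n, aeval X ((Polynomial.X - C c) ^ n) =
      (X - c • (1 : Matrix (Fin k) (Fin k) ℂ)) ^ n := by
    intro n
    simp [Algebra.algebraMap_eq_smul_one]
  refine hX ⟨c, fun h0 => ?_, ?_⟩
  · rw [← hpow] at h0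
    have h1 := natDegree_le_of_dvd (minpoly.dvd ℂ X h0) (pow_ne_zero _ (X_sub_C_ne_zero c))
    rw [heq, natDegree_pow, natDegree_pow, natDegree_X_sub_C] at h1
    omega
  · rw [← hpow, ← heq, minpoly.aeval]

end Minpoly

/-! ### Continuity of the functional calculus -/

/-- `f[X]` is the value at `X` of the limit of interpolation polynomials whose nodes tend to the
zeros of the minimal polynomial, or of a multiple of it. -/
theorem NodesTo.exists_polyLim_matCalc {ι J : Type*} [DecidableEq J] {U : Ultrafilter ι}
    {Ω : Set ℂ} {f : ℂ → ℂ} {k : ℕ} {z : ι → J → ℂ} {w : J → ℂ} {T : Finset J}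
    (h : NodesTo U Ω f k z w T) (hw : ∀ j ∈ T, w j ∈ Ω)
    (hcard : ∀ c, (T.filter fun j => w j = c).card + 1 ≤ k) {n : ℕ}
    {X : Matrix (Fin n) (Fin n) ℂ} (hX : X ∈ specMatO n Ω)
    (hroot : ∀ c, (minpoly ℂ X).rootMultiplicity c ≤ (T.filter fun j => w j = c).card) :
    ∃ P, PolyLim U (fun t => interp f T (z t)) P ∧ aeval X P = matCalc Ω f X := by
  obtain ⟨P, hP, hH⟩ := h.exists_hermite hw hcard
  refine ⟨P, hP, (matCalc_eq hX fun c hc => ?_).symm⟩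
  have hpos : 0 < (T.filter fun j => w j = c).card :=
    ((rootMultiplicity_pos (minpoly_ne_zero X)).2 hc).trans_le (hroot c)
  obtain ⟨j, hj⟩ := Finset.card_pos.1 hpos
  obtain ⟨hjT, rfl⟩ := Finset.mem_filter.1 hj
  exact ⟨fun hcl s hs => (hH j hjT).2 hcl s (hs.trans_le (hroot _)), fun _ => (hH j hjT).1⟩

/-- `f[X]` is approximated by values at `X` of interpolation polynomials with different nodes near
the zeros of the minimal polynomial. -/
theorem exists_approx {Ω : Set ℂ} {f : ℂ → ℂ} {k : ℕ} (hk : 1 ≤ k)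
    (h : ∀ c ∈ Ω, LocDiffBound Ω f k c) {X : Matrix (Fin k) (Fin k) ℂ}
    (hX : X ∈ specMatO k Ω \ singMat k) {d : ℕ} (hd : (minpoly ℂ X).natDegree = d) {η : ℝ}
    (hη : 0 < η) : ∃ z y : Fin d → ℂ, minpoly ℂ X = Lagrange.nodal Finset.univ z ∧
      (∀ j, z j ∈ spectrum ℂ X) ∧
      Function.Injective y ∧ (∀ j, y j ∈ Ω) ∧ (∀ j, ‖y j - z j‖ < η) ∧
      ‖aeval X (interp f Finset.univ y) - matCalc Ω f X‖ < η := by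
  obtain ⟨z, hz⟩ := exists_nodal_eq (minpoly.monic (Matrix.isIntegral X)) hd
  have hmult : ∀ c, (minpoly ℂ X).rootMultiplicity c =
      (Finset.univ.filter fun j => z j = c).card := fun c => by rw [hz, rootMultiplicity_nodal]
  have hspec : ∀ j, z j ∈ spectrum ℂ X := fun j => mem_spectrum_of_isRoot (by
    rw [hz]; exact Lagrange.eval_nodal_at_node (Finset.mem_univ j))
  have hΩ : ∀ j, z j ∈ Ω := fun j => hX.1.1 (hspec j)
  have hcl : ∀ i j, i ≠ j → z i = z j → z i ∈ clusterPts Ω := by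
    intro i j hij he
    refine hX.1.2 _ ?_
    rw [hmult]
    refine Finset.one_lt_card.2 ⟨i, ?_, j, ?_, hij⟩ <;> simp [he]
  obtain ⟨y, hy1, hy2, hy3⟩ := exists_seq_injective hΩ hcl
  have hlim := tendsto_of_norm_sub_lt hy3
  have hN : NodesTo (hyperfilter ℕ) Ω f k y z Finset.univ :=
    { injOn := Eventually.of_forall fun t => (hy1 t).injOn
      mem := Eventually.of_forall fun t j _ => hy2 t j
      tendsto := fun j _ => hlim j
      bound := fun j _ => h _ (hΩ j)
      card_le := fun c => by
        have := rootMultiplicity_minpoly_lt hk hX.2 c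
        rw [hmult] at this
        omega }
  obtain ⟨P, hP, hPX⟩ := hN.exists_polyLim_matCalc (fun j _ => hΩ j)
    (fun c => by rw [← hmult]; exact rootMultiplicity_minpoly_lt hk hX.2 c) hX.1
    (fun c => (hmult c).le)
  have h1 : ∀ᶠ t in (hyperfilter ℕ : Filter ℕ),
      ‖aeval X (interp f Finset.univ (y t)) - matCalc Ω f X‖ < η := by
    have h2 := hP.2 (fun _ => X) X tendsto_const_nhds
    rw [hPX] at h2
    filter_upwards [h2 (Metric.ball_mem_nhds _ hη)] with t ht
    rwa [← dist_eq_norm]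
  have h2 : ∀ᶠ t in (hyperfilter ℕ : Filter ℕ), ∀ j, ‖y t j - z j‖ < η := by
    rw [Filter.eventually_all]
    intro j
    filter_upwards [hlim j (Metric.ball_mem_nhds _ hη)] with t ht
    rwa [← dist_eq_norm]
  obtain ⟨t, ht1, ht2⟩ := (h1.and h2).exists
  exact ⟨z, y t, hz, hspec, hy1 t, hy2 t, ht2, ht1⟩

theorem mem_spectrum_of_tendsto {ι : Type*} {U : Filter ι} [U.NeBot] {k : ℕ}
    {A : ι → Matrix (Fin k) (Fin k) ℂ} {B : Matrix (Fin k) (Fin k) ℂ} {g : ι → ℂ} {l : ℂ}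
    (hA : Tendsto A U (𝓝 B)) (hg : Tendsto g U (𝓝 l)) (h : ∀ᶠ t in U, g t ∈ spectrum ℂ (A t)) :
    l ∈ spectrum ℂ B := by
  have hmem : ∀ (c : ℂ) (M : Matrix (Fin k) (Fin k) ℂ), c ∈ spectrum ℂ M ↔
      (c • (1 : Matrix (Fin k) (Fin k) ℂ) - M).det = 0 := by
    intro c M
    rw [spectrum.mem_iff, Algebra.algebraMap_eq_smul_one, Matrix.isUnit_iff_isUnit_det,
      isUnit_iff_ne_zero, not_not]
  rw [hmem]
  have hc : Continuous fun M : Matrix (Fin k) (Fin k) ℂ => M.det :=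
    Continuous.matrix_det continuous_id
  have h1 := (hc.tendsto _).comp ((hg.smul_const (1 : Matrix (Fin k) (Fin k) ℂ)).sub hA)
  refine tendsto_nhds_unique h1 (tendsto_const_nhds.congr' ?_)
  filter_upwards [h] with t ht
  exact ((hmem _ _).1 ht).symm

/-- For X near X₀, replace `f[X]` by P[X] with P interpolating at different nodes close to the roots
of the minimal polynomial. The nodes converge into the spectrum of X₀, and the limit of P represents
`f[X₀]`. -/
theorem continuousOn_matCalc {Ω : Set ℂ} {f : ℂ → ℂ} {k : ℕ} (hk : 2 ≤ k)
    (h : ∀ c ∈ Ω, LocDiffBound Ω f k c) :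
    ContinuousOn (matCalc Ω f) (specMatO k Ω \ singMat k) := by
  intro X₀ hX₀
  rw [ContinuousWithinAt, tendsto_iff_ultrafilter]
  intro U hU
  have hUS : ∀ᶠ X in (U : Filter (Matrix (Fin k) (Fin k) ℂ)), X ∈ specMatO k Ω \ singMat k :=
    hU self_mem_nhdsWithin
  have hUX : Tendsto (fun X => X) (U : Filter (Matrix (Fin k) (Fin k) ℂ)) (𝓝 X₀) :=
    hU.trans nhdsWithin_le_nhds
  -- Otherwise ‖X - X₀‖ is eventually positive and can serve as the precision of the approximation,
  -- which then tends to zero.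
  by_cases hpure : ∀ᶠ X in (U : Filter (Matrix (Fin k) (Fin k) ℂ)), X = X₀
  · exact tendsto_const_nhds.congr' (hpure.mono fun X hX => by rw [hX])
  have hne : ∀ᶠ X in (U : Filter (Matrix (Fin k) (Fin k) ℂ)), X ≠ X₀ :=
    Ultrafilter.eventually_not.2 hpure
  -- Only finitely many degrees occur, so the ultrafilter picks one; the number of nodes becomes
  -- constant.
  obtain ⟨d, hdk, hd⟩ : ∃ d ∈ Set.Iic k, ∀ᶠ X in (U : Filter (Matrix (Fin k) (Fin k) ℂ)),
      (minpoly ℂ X).natDegree = d :=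
    (Ultrafilter.eventually_exists_mem_iff (Set.finite_Iic k)).1
      (Eventually.of_forall fun X => ⟨_, natDegree_minpoly_le X, rfl⟩)
  rw [Set.mem_Iic] at hdk
  have hex : ∀ X : Matrix (Fin k) (Fin k) ℂ, ∃ z y : Fin d → ℂ,
      X ∈ specMatO k Ω \ singMat k → (minpoly ℂ X).natDegree = d → X ≠ X₀ →
      minpoly ℂ X = Lagrange.nodal Finset.univ z ∧
      (∀ j, z j ∈ spectrum ℂ X) ∧
      Function.Injective y ∧ (∀ j, y j ∈ Ω) ∧ (∀ j, ‖y j - z j‖ < ‖X - X₀‖) ∧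
      ‖aeval X (interp f Finset.univ y) - matCalc Ω f X‖ < ‖X - X₀‖ := by
    intro X
    by_cases hX : X ∈ specMatO k Ω \ singMat k ∧ (minpoly ℂ X).natDegree = d ∧ X ≠ X₀
    · obtain ⟨z, y, hzy⟩ := exists_approx (by omega) h hX.1 hX.2.1
        (norm_pos_iff.2 (sub_ne_zero.2 hX.2.2))
      exact ⟨z, y, fun _ _ _ => hzy⟩
    · exact ⟨0, 0, fun h1 h2 h3 => absurd ⟨h1, h2, h3⟩ hX⟩
  choose z y hzy using hex
  have hev : ∀ᶠ X in (U : Filter (Matrix (Fin k) (Fin k) ℂ)),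
      minpoly ℂ X = Lagrange.nodal Finset.univ (z X) ∧
      (∀ j, z X j ∈ spectrum ℂ X) ∧
      Function.Injective (y X) ∧ (∀ j, y X j ∈ Ω) ∧ (∀ j, ‖y X j - z X j‖ < ‖X - X₀‖) ∧
      ‖aeval X (interp f Finset.univ (y X)) - matCalc Ω f X‖ < ‖X - X₀‖ := by
    filter_upwards [hUS, hd, hne] with X h1 h2 h3
    exact hzy X h1 h2 h3
  have hdist : Tendsto (fun X => ‖X - X₀‖) (U : Filter (Matrix (Fin k) (Fin k) ℂ)) (𝓝 0) :=
    tendsto_iff_norm_sub_tendsto_zero.1 hUX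
  have hzlim : ∀ j, ∃ l, Tendsto (fun X => z X j) (U : Filter (Matrix (Fin k) (Fin k) ℂ))
      (𝓝 l) := by
    intro j
    refine exists_tendsto_of_bounded U
      (M := (‖X₀‖ + 1) * ‖(1 : Matrix (Fin k) (Fin k) ℂ)‖) ?_
    filter_upwards [hev, hUX.norm (Iio_mem_nhds (lt_add_one ‖X₀‖))] with X h1 h2
    refine (spectrum.norm_le_norm_mul_of_mem (h1.2.1 j)).trans ?_
    exact mul_le_mul_of_nonneg_right (le_of_lt h2) (norm_nonneg _)
  choose w hw using hzlim
  have hylim : ∀ j, Tendsto (fun X => y X j) (U : Filter (Matrix (Fin k) (Fin k) ℂ))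
      (𝓝 (w j)) := by
    intro j
    refine tendsto_of_tendsto_of_dist (hw j) (squeeze_zero' (Eventually.of_forall fun _ =>
      dist_nonneg) ?_ hdist)
    filter_upwards [hev] with X hX
    rw [dist_comm, dist_eq_norm]
    exact (hX.2.2.2.2.1 j).le
  have hwspec : ∀ j, w j ∈ spectrum ℂ X₀ := fun j =>
    mem_spectrum_of_tendsto hUX (hw j) (hev.mono fun X hX => hX.2.1 j)
  have hwΩ : ∀ j, w j ∈ Ω := fun j => hX₀.1.1 (hwspec j)
  -- The minimal polynomials converge to a polynomial annihilating X₀, possibly of larger degree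
  -- than that of X₀; hence only divisibility.
  have hdvd : minpoly ℂ X₀ ∣ Lagrange.nodal Finset.univ w := by
    refine minpoly.dvd ℂ X₀ ?_
    have h1 := (PolyLim.nodal (U := (U : Filter (Matrix (Fin k) (Fin k) ℂ))) (z := z) (w := w)
      Finset.univ fun j _ => hw j).2 (fun X => X) X₀ hUX
    refine tendsto_nhds_unique h1 (tendsto_const_nhds.congr' ?_)
    filter_upwards [hev] with X hX
    rw [← hX.1, minpoly.aeval]
  have hroot : ∀ c, (minpoly ℂ X₀).rootMultiplicity c ≤
      (Finset.univ.filter fun j => w j = c).card := by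
    intro c
    rw [← rootMultiplicity_nodal]
    exact rootMultiplicity_le_rootMultiplicity_of_dvd Lagrange.nodal_ne_zero hdvd c
  have hN : NodesTo U Ω f k y w Finset.univ :=
    { injOn := hev.mono fun X hX => hX.2.2.1.injOn
      mem := hev.mono fun X hX j _ => hX.2.2.2.1 j
      tendsto := fun j _ => hylim j
      bound := fun j _ => h _ (hwΩ j)
      card_le := fun c => (Finset.card_le_univ _).trans (by simpa using hdk) }
  have key : ∃ P, PolyLim (U : Filter (Matrix (Fin k) (Fin k) ℂ))
      (fun X => interp f Finset.univ (y X)) P ∧ aeval X₀ P = matCalc Ω f X₀ := by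
    by_cases hfib : ∀ c, (Finset.univ.filter fun j => w j = c).card + 1 ≤ k
    · exact hN.exists_polyLim_matCalc (fun j _ => hwΩ j) hfib hX₀.1 hroot
    -- The exceptional case: d = k and all nodes tend to c. Dropping one node leaves an admissible
    -- Hermite problem, and the last Newton term is treated separately.
    push Not at hfib
    obtain ⟨c, hc⟩ := hfib
    have hall : (Finset.univ.filter fun j => w j = c) = Finset.univ :=
      Finset.eq_univ_of_card _ (le_antisymm (Finset.card_le_univ _) (by
        rw [Fintype.card_fin]; omega))
    have hwc : ∀ j, w j = c := fun j =>
      (Finset.mem_filter.1 (hall ▸ Finset.mem_univ j : j ∈ Finset.univ.filter _)).2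
    rw [hall, Finset.card_fin] at hc
    obtain rfl : d = k := by omega
    obtain ⟨m, rfl⟩ : ∃ m, d = m + 1 := ⟨d - 1, by omega⟩
    let T : Finset (Fin (m + 1)) := Finset.univ.erase 0
    have hT : T.card = m := by simp [T]
    have hfT : ∀ c', (T.filter fun j => w j = c').card ≤ m := fun c' =>
      (Finset.card_filter_le _ _).trans hT.le
    have hins : insert 0 T = (Finset.univ : Finset (Fin (m + 1))) :=
      Finset.insert_erase (Finset.mem_univ _)
    obtain ⟨P, hP, hPX⟩ := (hN.mono (Finset.subset_univ T)).exists_polyLim_matCalc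
      (fun j _ => hwΩ j) (fun c' => by have := hfT c'; omega) hX₀.1 (fun c' => by
        by_cases hcc : c' = c
        · have h1 : (T.filter fun j => w j = c') = T :=
            Finset.filter_true_of_mem fun j _ => by rw [hwc j, hcc]
          have h2 := rootMultiplicity_minpoly_lt (by omega) hX₀.2 c'
          rw [h1, hT]
          omega
        · have h1 := hroot c'
          have h2 : (Finset.univ.filter fun j => w j = c') = ∅ :=
            Finset.filter_false_of_mem fun j _ => by rw [hwc j]; exact Ne.symm hcc
          rw [h2, Finset.card_empty] at h1
          omega)
    obtain ⟨l, hl⟩ := hN.exists_tendsto_nodeDiff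
    refine ⟨P + C l * Lagrange.nodal T w, (hP.add ((PolyLim.C hl).mul
      (PolyLim.nodal (w := w) T fun j _ => hylim j))).congr' ?_, ?_⟩
    · filter_upwards [hN.injOn] with X hX
      have := interp_insert (f := f) (z := y X) (s := T)
        (Finset.notMem_erase 0 Finset.univ) (by rwa [hins])
      rw [hins] at this
      exact this.symm
    · have hnod : ∀ S : Finset (Fin (m + 1)), aeval X₀ (Lagrange.nodal S w) =
          (X₀ - c • (1 : Matrix (Fin (m + 1)) (Fin (m + 1)) ℂ)) ^ S.card := by
        intro S
        rw [Lagrange.nodal, Finset.prod_congr rfl fun j _ => by rw [hwc j], Finset.prod_const]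
        simp [Algebra.algebraMap_eq_smul_one]
      have hz0 : (X₀ - c • (1 : Matrix (Fin (m + 1)) (Fin (m + 1)) ℂ)) ^ (m + 1) = 0 := by
        have h1 := hnod Finset.univ
        rw [Finset.card_fin] at h1
        rw [← h1]
        obtain ⟨q, hq⟩ := hdvd
        rw [hq, map_mul, minpoly.aeval, zero_mul]
      -- Here X₀ ∉ `singMat` is decisive: the extra term vanishes at X₀ whatever the limit l of the
      -- divided differences is.
      have hz1 : (X₀ - c • (1 : Matrix (Fin (m + 1)) (Fin (m + 1)) ℂ)) ^ m = 0 := by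
        by_contra h0
        exact hX₀.2 ⟨c, h0, hz0⟩
      rw [map_add, map_mul, hnod T, hT, hz1, mul_zero, add_zero, hPX]
  obtain ⟨P, hP, hPX⟩ := key
  rw [← hPX]
  refine tendsto_of_tendsto_of_dist (hP.2 (fun X => X) X₀ hUX) (squeeze_zero'
    (Eventually.of_forall fun _ => dist_nonneg) ?_ hdist)
  filter_upwards [hev] with X hX
  rw [dist_eq_norm]
  exact hX.2.2.2.2.2.le

/-! ### Diagonalizable matrices -/

theorem IsDiagonalizable.exists_aeval {k : ℕ} {X : Matrix (Fin k) (Fin k) ℂ}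
    (hX : IsDiagonalizable X) : ∃ (P : Matrix (Fin k) (Fin k) ℂ) (v : Fin k → ℂ), IsUnit P.det ∧
      ∀ r : ℂ[X], aeval X r = P⁻¹ * Matrix.diagonal (fun i => r.eval (v i)) * P := by
  obtain ⟨P, hPu, hD⟩ := hX
  have hdet : IsUnit P.det := (Matrix.isUnit_iff_isUnit_det P).1 hPu
  refine ⟨P, fun i => (P * X * P⁻¹) i i, hdet, fun r => ?_⟩
  set v : Fin k → ℂ := fun i => (P * X * P⁻¹) i i with hv
  have hXD : P * X = Matrix.diagonal v * P := by
    have hd : P * X * P⁻¹ = Matrix.diagonal v := hD.diagonal_diag.symm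
    rw [← hd, Matrix.mul_assoc (P * X), Matrix.nonsing_inv_mul P hdet, Matrix.mul_one]
  have hpow : ∀ n, P * X ^ n = Matrix.diagonal (fun i => v i ^ n) * P := by
    intro n
    induction n with
    | zero => simp
    | succ n ih =>
      rw [pow_succ, ← Matrix.mul_assoc, ih, Matrix.mul_assoc, hXD, ← Matrix.mul_assoc,
        Matrix.diagonal_mul_diagonal]
      simp only [pow_succ]
  have hr : P * aeval X r = Matrix.diagonal (fun i => r.eval (v i)) * P := by
    induction r using Polynomial.induction_on' with
    | add a b ha hb =>
      rw [map_add, Matrix.mul_add, ha, hb, ← Matrix.add_mul, Matrix.diagonal_add]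
      simp only [eval_add]
    | monomial n a =>
      have h1 : (fun i => (monomial n a).eval (v i)) = a • fun i => v i ^ n := by
        funext i; simp [eval_monomial]
      rw [h1, Matrix.diagonal_smul, Matrix.smul_mul, ← hpow, aeval_monomial,
        Algebra.algebraMap_eq_smul_one, smul_mul_assoc, one_mul, Matrix.mul_smul]
  rw [Matrix.mul_assoc, ← hr, ← Matrix.mul_assoc, Matrix.nonsing_inv_mul P hdet, Matrix.one_mul]

theorem IsDiagonalizable.aeval_eq_zero {k : ℕ} {X : Matrix (Fin k) (Fin k) ℂ}
    (hX : IsDiagonalizable X) {p q : ℂ[X]} (hpq : ∀ c, p.eval c = 0 → q.eval c = 0)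
    (hp : aeval X p = 0) : aeval X q = 0 := by
  obtain ⟨P, v, hdet, hr⟩ := hX.exists_aeval
  have h1 : Matrix.diagonal (fun i => p.eval (v i)) = 0 := by
    have h2 : P * aeval X p * P⁻¹ = Matrix.diagonal (fun i => p.eval (v i)) := by
      rw [hr, Matrix.mul_assoc P⁻¹, ← Matrix.mul_assoc, Matrix.mul_nonsing_inv P hdet,
        Matrix.one_mul, Matrix.mul_assoc, Matrix.mul_nonsing_inv P hdet, Matrix.mul_one]
    rw [← h2, hp]
    simp
  have h2 : (fun i => q.eval (v i)) = 0 := by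
    funext i
    refine hpq _ ?_
    have := congrFun (congrFun h1 i) i
    simpa using this
  rw [hr, h2]
  simp

/-- For a diagonalizable matrix, whether p[X] = 0 depends only on the zero set of p. So a square
factor of the minimal polynomial could be reduced, against minimality, and (X-c)^k = 0 forces
(X-c)^(k-1) = 0. -/
theorem diagMat_subset {k : ℕ} (hk : 2 ≤ k) (Ω : Set ℂ) :
    diagMat k Ω ⊆ specMatO k Ω \ singMat k := by
  intro X hX
  refine ⟨⟨hX.1, fun c hc => ?_⟩, ?_⟩
  · exfalso
    obtain ⟨r, hr⟩ := (le_rootMultiplicity_iff (minpoly_ne_zero X)).1 hc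
    have h0 : aeval X ((Polynomial.X - C c) * r) = 0 := by
      refine hX.2.aeval_eq_zero (p := minpoly ℂ X) (fun a ha => ?_) (minpoly.aeval ℂ X)
      rw [hr, eval_mul, eval_pow, mul_eq_zero, pow_eq_zero_iff two_ne_zero] at ha
      rw [eval_mul, mul_eq_zero]
      exact ha
    have hr0 : r ≠ 0 := fun h => minpoly_ne_zero X (by rw [hr, h, mul_zero])
    have h1 := natDegree_le_of_dvd (minpoly.dvd ℂ X h0) (mul_ne_zero (X_sub_C_ne_zero c) hr0)
    rw [hr, natDegree_mul (pow_ne_zero _ (X_sub_C_ne_zero c)) hr0,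
      natDegree_mul (X_sub_C_ne_zero c) hr0, natDegree_pow, natDegree_X_sub_C] at h1
    omega
  · rintro ⟨c, h1, h2⟩
    have hpow : ∀ n, aeval X ((Polynomial.X - C c) ^ n) =
        (X - c • (1 : Matrix (Fin k) (Fin k) ℂ)) ^ n := by
      intro n
      simp [Algebra.algebraMap_eq_smul_one]
    rw [← hpow] at h1 h2
    refine h1 (hX.2.aeval_eq_zero (fun a ha => ?_) h2)
    rw [eval_pow, pow_eq_zero_iff (by omega)] at ha ⊢
    exact ha

theorem smul_one_mem_diagMat {k : ℕ} {Ω : Set ℂ} {c : ℂ} (hc : c ∈ Ω) :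
    c • (1 : Matrix (Fin k) (Fin k) ℂ) ∈ diagMat k Ω := by
  refine ⟨fun a ha => ?_, 1, isUnit_one, ?_⟩
  · have : a = c := by
      by_contra hne
      refine ha ?_
      rw [spectrum.mem_resolventSet_iff, Algebra.algebraMap_eq_smul_one, ← sub_smul]
      exact (isUnit_one.smul (Units.mk0 (a - c) (sub_ne_zero.2 hne)))
    rwa [this]
  · simp

theorem bounded_of_continuousOn {Ω : Set ℂ} {k : ℕ}
    {F : Matrix (Fin k) (Fin k) ℂ → Matrix (Fin k) (Fin k) ℂ}
    (h : ContinuousOn F (diagMat k Ω)) {c : ℂ} (hc : c ∈ Ω) :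
    ∃ ε > (0 : ℝ), ∃ M > (0 : ℝ), ∀ X ∈ diagMat k Ω,
      ‖X - c • (1 : Matrix (Fin k) (Fin k) ℂ)‖ ≤ ε → ‖F X‖ ≤ M := by
  have h1 := (h _ (smul_one_mem_diagMat hc)).norm (Iio_mem_nhds (lt_add_one _))
  rw [mem_map, Metric.mem_nhdsWithin_iff] at h1
  obtain ⟨ε, hε, hs⟩ := h1
  refine ⟨ε / 2, by positivity, ‖F (c • 1)‖ + 1, by positivity, fun X hX hXc => ?_⟩
  refine le_of_lt (hs ⟨?_, hX⟩)
  rw [Metric.mem_ball, dist_eq_norm]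
  linarith

/-- A triangular matrix with different diagonal entries is diagonalizable. -/
theorem mem_diagMat_of_blockTriangular {k : ℕ} {Ω : Set ℂ} {A : Matrix (Fin k) (Fin k) ℂ}
    (hA : A.BlockTriangular id) (hinj : Function.Injective fun i => A i i)
    (hΩ : ∀ i, A i i ∈ Ω) : A ∈ diagMat k Ω ∧ ∀ c ∈ spectrum ℂ A, ∃ i, A i i = c := by
  have hcp : A.charpoly = ∏ i, (Polynomial.X - C (A i i)) :=
    Matrix.charpoly_of_isUpperTriangular A hA
  have hdet : ∀ c, (c • (1 : Matrix (Fin k) (Fin k) ℂ) - A).det = ∏ i, (c - A i i) := by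
    intro c
    have h1 := Matrix.eval_charpoly A c
    rw [hcp, eval_prod] at h1
    rw [Matrix.smul_one_eq_diagonal]
    simpa using h1.symm
  have hspec : ∀ c ∈ spectrum ℂ A, ∃ i, A i i = c := by
    intro c hc
    rw [spectrum.mem_iff, Algebra.algebraMap_eq_smul_one, Matrix.isUnit_iff_isUnit_det,
      isUnit_iff_ne_zero, not_not, hdet, Finset.prod_eq_zero_iff] at hc
    obtain ⟨i, -, hi⟩ := hc
    exact ⟨i, (sub_eq_zero.1 hi).symm⟩
  refine ⟨⟨fun c hc => ?_, ?_⟩, hspec⟩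
  · obtain ⟨i, rfl⟩ := hspec c hc
    exact hΩ i
  have hev : ∀ i, ∃ v : Fin k → ℂ, v ≠ 0 ∧ A.mulVec v = A i i • v := by
    intro i
    have h0 : (A i i • (1 : Matrix (Fin k) (Fin k) ℂ) - A).det = 0 := by
      rw [hdet]
      exact Finset.prod_eq_zero (Finset.mem_univ i) (sub_self _)
    obtain ⟨v, hv, h1⟩ := Matrix.exists_mulVec_eq_zero_iff.2 h0
    refine ⟨v, hv, ?_⟩
    rw [Matrix.sub_mulVec, Matrix.smul_mulVec, Matrix.one_mulVec, sub_eq_zero] at h1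
    exact h1.symm
  choose v hv0 hv using hev
  have hli : LinearIndependent ℂ v :=
    Module.End.eigenvectors_linearIndependent' (Matrix.toLin' A) (fun i => A i i) hinj v fun i =>
      Module.End.hasEigenvector_iff.2 ⟨Module.End.mem_eigenspace_iff.2 (by
        rw [Matrix.toLin'_apply]; exact hv i), hv0 i⟩
  let V : Matrix (Fin k) (Fin k) ℂ := Matrix.of fun i j => v j i
  have hV : IsUnit V := Matrix.linearIndependent_cols_iff_isUnit.1 hli
  have hVd : IsUnit V.det := (Matrix.isUnit_iff_isUnit_det V).1 hV
  have hAV : A * V = V * Matrix.diagonal fun i => A i i := by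
    ext i j
    rw [Matrix.mul_diagonal]
    have := congrFun (hv j) i
    rw [Pi.smul_apply, smul_eq_mul, mul_comm] at this
    exact this
  refine ⟨V⁻¹, (Matrix.isUnit_nonsing_inv_iff).2 hV, ?_⟩
  rw [Matrix.nonsing_inv_nonsing_inv V hVd, Matrix.mul_assoc, hAV, ← Matrix.mul_assoc,
    Matrix.nonsing_inv_mul V hVd, Matrix.one_mul]
  exact Matrix.isDiag_diagonal _

/-! ### Bidiagonal matrices and divided differences -/

/-- The matrix with ones above the diagonal. -/
def shiftMat (n : ℕ) : Matrix (Fin (n + 1)) (Fin (n + 1)) ℂ :=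
  Matrix.of fun i j => if (i : ℕ) + 1 = j then 1 else 0

/-- The matrix with diagonal `z` and all entries above the diagonal equal to `η`. -/
def bidiag {n : ℕ} (z : Fin (n + 1) → ℂ) (η : ℂ) : Matrix (Fin (n + 1)) (Fin (n + 1)) ℂ :=
  Matrix.diagonal z + η • shiftMat n

theorem bidiag_apply {n : ℕ} (z : Fin (n + 1) → ℂ) (η : ℂ) (i j : Fin (n + 1)) :
    bidiag z η i j = (if i = j then z i else 0) + if (i : ℕ) + 1 = j then η else 0 := by
  simp [bidiag, shiftMat, Matrix.diagonal_apply]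

/-- Each factor moves the column index by at most one, with weight η. Column j is out of reach of
fewer than j factors, and j factors reach it in exactly one way. -/
theorem bidiag_pow {n : ℕ} (z : Fin (n + 1) → ℂ) (η : ℂ) (m : ℕ) :
    ∀ j : Fin (n + 1), (m < j → (bidiag z η ^ m) 0 j = 0) ∧
      (m = j → (bidiag z η ^ m) 0 j = η ^ m) := by
  induction m with
  | zero =>
    intro j
    refine ⟨fun h => ?_, fun h => ?_⟩
    · rw [pow_zero, Matrix.one_apply_ne]
      exact fun e => by simp [← e] at h
    · obtain rfl : j = 0 := Fin.ext h.symm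
      simp
  | succ m ih =>
    intro j
    have hterm : ∀ i : Fin (n + 1), m < i → (bidiag z η ^ m) 0 i * bidiag z η i j = 0 :=
      fun i hi => by rw [(ih i).1 hi, zero_mul]
    have hzero : ∀ i : Fin (n + 1), i ≠ j → (i : ℕ) + 1 ≠ j → bidiag z η i j = 0 :=
      fun i h1 h2 => by rw [bidiag_apply, if_neg h1, if_neg h2, add_zero]
    refine ⟨fun h => ?_, fun h => ?_⟩ <;> rw [pow_succ, Matrix.mul_apply]
    · refine Finset.sum_eq_zero fun i _ => ?_
      by_cases hi : m < i
      · exact hterm i hi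
      · rw [hzero i (fun e => hi (by rw [e]; omega)) (by omega), mul_zero]
    · have hm : m < n + 1 := by have := j.2; omega
      rw [Finset.sum_eq_single ⟨m, hm⟩]
      · rw [(ih _).2 rfl, bidiag_apply, if_neg (fun e => by rw [← e] at h; simp at h),
          if_pos (by simpa using h), zero_add, pow_succ]
      · intro i _ him
        by_cases hi : m < i
        · exact hterm i hi
        · have hne : (i : ℕ) ≠ m := fun e => him (Fin.ext e)
          rw [hzero i (fun e => hi (by rw [e]; omega)) (by omega), mul_zero]
      · intro h; exact absurd (Finset.mem_univ _) h

theorem aeval_bidiag {n : ℕ} (z : Fin (n + 1) → ℂ) (η : ℂ) {P : ℂ[X]}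
    (hP : P.degree < (n + 1 : ℕ)) :
    (aeval (bidiag z η) P) 0 (Fin.last n) = P.coeff n * η ^ n := by
  have hd : P.natDegree < n + 1 := by
    by_cases h0 : P = 0
    · simp [h0]
    · rwa [natDegree_lt_iff_degree_lt h0]
  rw [aeval_eq_sum_range' hd, Matrix.sum_apply, Finset.sum_range_succ, Finset.sum_eq_zero,
    zero_add, Matrix.smul_apply, (bidiag_pow z η n _).2 (by simp), smul_eq_mul]
  intro m hm
  rw [Matrix.smul_apply, (bidiag_pow z η m _).1 (by simpa using hm), smul_zero]

/-- Only the term of degree n of the interpolation polynomial reaches the corner, and its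
coefficient is the divided difference. -/
theorem matCalc_bidiag {Ω : Set ℂ} {f : ℂ → ℂ} {n : ℕ} {z : Fin (n + 1) → ℂ}
    (hz : Function.Injective z) (hΩ : ∀ i, z i ∈ Ω) (η : ℂ) :
    bidiag z η ∈ diagMat (n + 1) Ω ∧
      (matCalc Ω f (bidiag z η)) 0 (Fin.last n) = divDiff f n z * η ^ n := by
  have hdiag : ∀ i, bidiag z η i i = z i := fun i => by simp [bidiag_apply]
  obtain ⟨hmem, hspec⟩ := mem_diagMat_of_blockTriangular (Ω := Ω) (A := bidiag z η)
    (fun i j hij => by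
      have hij' : (j : ℕ) < i := hij
      rw [bidiag_apply, if_neg (ne_of_gt (show j < i from hij)), if_neg (by omega), add_zero])
    (by simpa only [hdiag] using hz) (fun i => by rw [hdiag]; exact hΩ i)
  have hzs : Set.InjOn z (Finset.univ : Finset (Fin (n + 1))) := hz.injOn
  refine ⟨hmem, ?_⟩
  rw [matCalc_eq_of_diag hmem (W := interp f Finset.univ z) fun c hc => by
    obtain ⟨i, rfl⟩ := hspec c hc
    rw [hdiag]
    exact eval_interp hzs (Finset.mem_univ i)]
  rw [aeval_bidiag z η (by simpa only [Finset.card_fin] using degree_interp_lt (f := f) hzs),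
    divDiff_eq_nodeDiff f n z hz, nodeDiff_image hzs, nodeDiff, Finset.card_fin,
    Nat.add_sub_cancel]

theorem isDDB_of_bounded {Ω : Set ℂ} {f : ℂ → ℂ} {n : ℕ}
    (h : ∀ c ∈ clusterPts Ω, ∃ ε > (0 : ℝ), ∃ M > (0 : ℝ), ∀ X ∈ diagMat (n + 1) Ω,
      ‖X - c • (1 : Matrix (Fin (n + 1)) (Fin (n + 1)) ℂ)‖ ≤ ε → ‖matCalc Ω f X‖ ≤ M) :
    IsDDB Ω f n := by
  intro c hc
  obtain ⟨ε, hε, M, hM, hb⟩ := h c hc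
  let L : Matrix (Fin (n + 1)) (Fin (n + 1)) ℂ →L[ℂ] ℂ :=
    LinearMap.toContinuousLinearMap (Matrix.entryLinearMap ℂ ℂ 0 (Fin.last n))
  -- Half of ε goes to the entries above the diagonal, half to the diagonal; the `+ 1` keeps the
  -- denominator positive.
  let η : ℝ := ε / (2 * (‖shiftMat n‖ + 1))
  have hη : 0 < η := by positivity
  refine ⟨‖L‖ * M / η ^ n + 1, by positivity, ε / 2, by positivity, fun z hz hinj hzc => ?_⟩
  obtain ⟨hmem, hentry⟩ := matCalc_bidiag (f := f) hinj hz (η : ℂ)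
  have hnorm : ‖bidiag z (η : ℂ) - c • (1 : Matrix (Fin (n + 1)) (Fin (n + 1)) ℂ)‖ ≤ ε := by
    have h1 : bidiag z (η : ℂ) - c • (1 : Matrix (Fin (n + 1)) (Fin (n + 1)) ℂ) =
        Matrix.diagonal (fun i => z i - c) + (η : ℂ) • shiftMat n := by
      rw [bidiag, Matrix.smul_one_eq_diagonal, add_sub_right_comm, Matrix.diagonal_sub]
    rw [h1]
    refine (norm_add_le _ _).trans ?_
    have h2 : ‖(Matrix.diagonal fun i => z i - c : Matrix (Fin (n + 1)) (Fin (n + 1)) ℂ)‖ ≤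
        ε / 2 := by
      rw [Matrix.l2_opNorm_diagonal]
      exact (pi_norm_le_iff_of_nonneg (by positivity)).2 hzc
    have h3 : ‖(η : ℂ) • shiftMat n‖ ≤ ε / 2 := by
      rw [norm_smul, Complex.norm_real, Real.norm_of_nonneg hη.le, div_mul_eq_mul_div,
        div_le_div_iff₀ (by positivity) (by positivity)]
      nlinarith [norm_nonneg (shiftMat n)]
    linarith
  have h1 := L.le_opNorm (matCalc Ω f (bidiag z (η : ℂ)))
  have h2 : L (matCalc Ω f (bidiag z (η : ℂ))) = divDiff f n z * (η : ℂ) ^ n := hentry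
  rw [h2, norm_mul, norm_pow, Complex.norm_real, Real.norm_of_nonneg hη.le] at h1
  have h3 : ‖divDiff f n z‖ * η ^ n ≤ ‖L‖ * M :=
    h1.trans (mul_le_mul_of_nonneg_left (hb _ hmem hnorm) (norm_nonneg _))
  rw [← le_div_iff₀ (by positivity)] at h3
  linarith

/-! ### Extension to a locally compact set -/

/-- The points of the closure of `Ω` near which the divided differences of `f` at up to `k` points
are bounded. -/
def extDomain (Ω : Set ℂ) (f : ℂ → ℂ) (k : ℕ) : Set ℂ := closure Ω ∩ {c | LocDiffBound Ω f k c}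

theorem isLocallyClosed_extDomain (Ω : Set ℂ) (f : ℂ → ℂ) (k : ℕ) :
    IsLocallyClosed (extDomain Ω f k) := by
  refine isClosed_closure.isLocallyClosed.inter (IsOpen.isLocallyClosed ?_)
  rw [Metric.isOpen_iff]
  rintro c ⟨ε, hε, M, hM, h⟩
  refine ⟨ε, hε, fun a ha => LocDiffBound.of_ball hM h ?_⟩
  rwa [← dist_eq_norm]

theorem LocDiffBound.exists_tendsto {Ω : Set ℂ} {f : ℂ → ℂ} {k : ℕ} (hk : 2 ≤ k) {c : ℂ}
    (hc : c ∈ closure Ω) (h : LocDiffBound Ω f k c) : ∃ l, Tendsto f (𝓝[Ω] c) (𝓝 l) := by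
  obtain ⟨ε, hε, M, hM, hL⟩ := h.lipschitz hk
  have hne : (𝓝[Ω] c).NeBot := mem_closure_iff_nhdsWithin_neBot.1 hc
  have hLip : LipschitzOnWith ⟨M, hM.le⟩ f (Ω ∩ Metric.closedBall c ε) :=
    LipschitzOnWith.of_dist_le_mul fun x hx y hy => by
      rw [dist_eq_norm, dist_eq_norm]; exact hL x hx y hy
  have hmem : 𝓝[Ω] c ≤ 𝓟 (Ω ∩ Metric.closedBall c ε) := by
    rw [le_principal_iff]
    exact inter_mem self_mem_nhdsWithin
      (mem_nhdsWithin_of_mem_nhds (Metric.closedBall_mem_nhds c hε))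
  have hcauchy : Cauchy (𝓝[Ω] c) := cauchy_nhds.mono nhdsWithin_le_nhds
  exact CompleteSpace.complete (hcauchy.map_of_le hLip.uniformContinuousOn hmem)

/-- Approximate the different points by sequences in `Ω`; they are eventually different, and by `δ <
ε` eventually in the larger ball. The divided differences of `f` there converge to that of `g`. -/
theorem DiffBound.extend {Ω : Set ℂ} {f g : ℂ → ℂ} {S : Set ℂ} {c : ℂ} {δ ε M : ℝ} (hδ : δ < ε)
    {m : ℕ} (h : DiffBound f (Ω ∩ Metric.closedBall c ε) m M) (hS : S ⊆ closure Ω)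
    (hg : ∀ x ∈ S, Tendsto f (𝓝[Ω] x) (𝓝 (g x))) :
    DiffBound g (S ∩ Metric.closedBall c δ) m M := by
  intro s hs hm
  have hseq : ∀ j : s, ∃ y : ℕ → ℂ, (∀ n, y n ∈ Ω) ∧ Tendsto y atTop (𝓝 (j : ℂ)) := fun j =>
    mem_closure_iff_seq_limit.1 (hS (hs j.2).1)
  choose y hyΩ hy using hseq
  have hinj : ∀ᶠ n in atTop, Function.Injective fun j => y j n := by
    have h1 : ∀ᶠ n in atTop, ∀ i j : s, i ≠ j → y i n ≠ y j n := by
      rw [eventually_all]; intro i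
      rw [eventually_all]; intro j
      by_cases hij : i = j
      · simp [hij]
      · have := ((hy i).sub (hy j)).eventually_ne
          (sub_ne_zero.2 fun e => hij (Subtype.ext e))
        exact this.mono fun n hn _ => sub_ne_zero.1 hn
    exact h1.mono fun n hn i j hij => by_contra fun hne => hn i j hne hij
  have hball : ∀ᶠ n in atTop, ∀ j, y j n ∈ Metric.closedBall c ε := by
    rw [eventually_all]
    intro j
    have h1 : Metric.closedBall c ε ∈ 𝓝 (j : ℂ) :=
      mem_of_superset (Metric.isOpen_ball.mem_nhds
        (Metric.closedBall_subset_ball hδ (hs j.2).2)) Metric.ball_subset_closedBall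
    exact hy j h1
  have hval : Set.InjOn (Subtype.val : s → ℂ) (Finset.univ : Finset s) :=
    Subtype.val_injective.injOn
  have hlim : Tendsto (fun n => nodeDiff f (Finset.univ : Finset s) fun j => y j n) atTop
      (𝓝 (nodeDiff g (Finset.univ : Finset s) Subtype.val)) := by
    rw [nodeDiff_eq_sum hval]
    have h1 : Tendsto (fun n => ∑ i : s, f (y i n) /
        ∏ j ∈ Finset.univ.erase i, (y i n - y j n)) atTop
        (𝓝 (∑ i : s, g i / ∏ j ∈ Finset.univ.erase i, ((i : ℂ) - j))) := by
      refine tendsto_finsetSum _ fun i _ => Tendsto.div ?_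
        (tendsto_finsetProd _ fun j _ => (hy i).sub (hy j)) ?_
      · exact (hg i (hs i.2).1).comp (tendsto_nhdsWithin_iff.2
          ⟨hy i, Eventually.of_forall (hyΩ i)⟩)
      · refine Finset.prod_ne_zero_iff.2 fun j hj => sub_ne_zero.2 fun e => ?_
        exact (Finset.mem_erase.1 hj).1 (Subtype.ext e.symm)
    refine h1.congr' (hinj.mono fun n hn => ?_)
    exact (nodeDiff_eq_sum hn.injOn).symm
  have himg : (Finset.univ : Finset s).image Subtype.val = s := by
    rw [Finset.univ_eq_attach, Finset.attach_image_val]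
  have hgs : nodeDiff g s id = nodeDiff g (Finset.univ : Finset s) Subtype.val := by
    rw [← nodeDiff_image hval, himg]
  rw [hgs]
  refine le_of_tendsto hlim.norm ?_
  filter_upwards [hinj, hball] with n h1 h2
  rw [← nodeDiff_image h1.injOn]
  refine h _ ?_ ?_
  · intro x hx
    obtain ⟨j, -, rfl⟩ := Finset.mem_image.1 (Finset.mem_coe.1 hx)
    exact ⟨hyΩ j n, h2 j⟩
  · rw [Finset.card_image_of_injective _ h1, Finset.card_univ, Fintype.card_coe, hm]

theorem exists_extension {Ω : Set ℂ} {f : ℂ → ℂ} {k : ℕ} (hk : 2 ≤ k)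
    (h : ∀ c ∈ Ω, LocDiffBound Ω f k c) :
    ∃ (G : Set ℂ) (g : ℂ → ℂ), Ω ⊆ G ∧ LocallyCompactSpace G ∧ Set.EqOn g f Ω ∧
      ∀ c ∈ G, LocDiffBound G g k c := by
  have hlim : ∀ x ∈ extDomain Ω f k, Tendsto f (𝓝[Ω] x) (𝓝 (extendFrom Ω f x)) := fun x hx =>
    tendsto_extendFrom (hx.2.exists_tendsto hk hx.1)
  refine ⟨extDomain Ω f k, extendFrom Ω f, fun c hc => ⟨subset_closure hc, h c hc⟩,
    (isLocallyClosed_extDomain Ω f k).locallyCompactSpace,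
    extendFrom_extends (continuousOn_of_locDiffBound hk h), ?_⟩
  rintro c ⟨-, ε, hε, M, hM, hb⟩
  exact ⟨ε / 2, by positivity, M, hM, fun m hm =>
    (hb m hm).extend (by linarith) Set.inter_subset_left hlim⟩

end MatCalc

end

/-! ### The equivalences and the extension -/

theorem theorem4p3 (Ω : Set ℂ) (f : ℂ → ℂ) (k : ℕ) (hk : 2 ≤ k) :
    List.TFAE [
      ∀ c ∈ MatCalc.clusterPts Ω, ∃ ε > (0 : ℝ), ∃ M > (0 : ℝ), ∀ X ∈ MatCalc.diagMat k Ω,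
        ‖X - c • (1 : Matrix (Fin k) (Fin k) ℂ)‖ ≤ ε → ‖MatCalc.matCalc Ω f X‖ ≤ M,
      ContinuousOn (MatCalc.matCalc Ω f) (MatCalc.diagMat k Ω),
      MatCalc.IsTC Ω f (k - 2) ∧
        ContinuousOn (MatCalc.matCalc Ω f) (MatCalc.specMatO k Ω \ MatCalc.singMat k),
      MatCalc.IsDDB Ω f (k - 1)] ∧
    (ContinuousOn (MatCalc.matCalc Ω f) (MatCalc.diagMat k Ω) →
      ∃ (G : Set ℂ) (g : ℂ → ℂ), Ω ⊆ G ∧ LocallyCompactSpace G ∧ Set.EqOn g f Ω ∧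
        ContinuousOn (MatCalc.matCalc G g) (MatCalc.diagMat k G)) := by
  obtain ⟨n, rfl⟩ : ∃ n, k = n + 2 := ⟨k - 2, by omega⟩
  have h21 : ContinuousOn (MatCalc.matCalc Ω f) (MatCalc.diagMat (n + 2) Ω) →
      ∀ c ∈ MatCalc.clusterPts Ω, ∃ ε > (0 : ℝ), ∃ M > (0 : ℝ),
        ∀ X ∈ MatCalc.diagMat (n + 2) Ω,
        ‖X - c • (1 : Matrix (Fin (n + 2)) (Fin (n + 2)) ℂ)‖ ≤ ε → ‖MatCalc.matCalc Ω f X‖ ≤ M :=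
    fun h c hc => MatCalc.bounded_of_continuousOn h hc.1
  constructor
  · tfae_have 2 → 1 := h21
    tfae_have 1 → 4 := MatCalc.isDDB_of_bounded
    tfae_have 4 → 3 := fun h =>
      ⟨MatCalc.isTC_of_locDiffBound fun c hc => h.locDiffBound hc,
        MatCalc.continuousOn_matCalc hk fun c hc => h.locDiffBound hc⟩
    tfae_have 3 → 2 := fun h => h.2.mono (MatCalc.diagMat_subset hk Ω)
    tfae_finish
  · intro h
    obtain ⟨G, g, hG, hlc, hgf, hb⟩ := MatCalc.exists_extension hk fun c hc =>
      (MatCalc.isDDB_of_bounded (h21 h)).locDiffBound hc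
    exact ⟨G, g, hG, hlc, hgf,
      (MatCalc.continuousOn_matCalc hk hb).mono (MatCalc.diagMat_subset hk G)⟩
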